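/- For a Coxeter matrix $M=(m_{st})_{s,t\in S}$ the Artin group $A=A(M)$ is the group generated by $S$ subject to the relations $sts\cdots=tst\cdots$ ($m_{st}$ letters on each side) for all $s\ne t$ with $m_{st}\neq\infty$. Let $\ell:A\to\mathbb Z$ be the homomorphism with $\ell(s)=1$ for all $s\in S$. Let $\mathrm{Aut}^*(A)$ be the group of automorphisms $\alpha$ of $A$ such that $\ell\circ\alpha=\ell$ or $\ell\circ\alpha=-\ell$. A transvection of a group $H$ with centre $Z$ is a homomorphism $H\to H$ of the form $x\mapsto x\,\lambda(x)$ for a function $\lambda:H\to Z$; let $\mathrm{Tv}(H)$ be the group of automorphisms of $H$ that are transvections. **Proposition 3.2.** (1) If $A$ is the Artin group of type $I_2(2n)$ with $n\ge 3$, of type $B_n$ with $n\geq 3$, or of type $F_4$, then $\mathrm{Tv}(A)\cong\mathbb Z$. (2) If $A$ is the Artin group of type $I_2(4)\equiv B_2$, then $\mathrm{Tv}(A)\cong D_\infty$, the infinite dihedral group. (3) In all these cases $\mathrm{Aut}(A)$ contains $\mathrm{Tv}(A)\rtimes\mathrm{Aut}^*(A)$ as a finite index subgroup: with $\mathrm{Aut}^*(A)$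 acting on $\mathrm{Tv}(A)$ by conjugation inside $\mathrm{Aut}(A)$, the inclusions of the two factors into $\mathrm{Aut}(A)$ induce an injective homomorphism $\mathrm{Tv}(A)\rtimes\mathrm{Aut}^*(A)\to\mathrm{Aut}(A)$ whose image has finite index. -/

import Mathlib

namespace ArtinTv

/-- The alternating word `a b a b ...` of length `m`, starting with `a`, in the free group. -/
def altWord {S : Type*} (a b : S) : ℕ → FreeGroup S
  | 0 => 1
  | m + 1 => FreeGroup.of a * altWord b a m

/-- The braid relators `(s t s ...) (t s t ...)⁻¹`, both words of length `M s t`. For `s = t` the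
relator is trivial, and so it is when `M s t = 0`, which is Mathlib's encoding of the label `∞`. -/
def braidRels {S : Type*} (M : CoxeterMatrix S) : Set (FreeGroup S) :=
  {r | ∃ s t : S, r = altWord s t (M s t) * (altWord t s (M s t))⁻¹}

/-- The Artin group of a Coxeter matrix. -/
abbrev ArtinGroup {S : Type*} (M : CoxeterMatrix S) : Type _ :=
  PresentedGroup (braidRels M)

theorem lift_altWord {S : Type*} (a b : S) (m : ℕ) :
    FreeGroup.lift (fun _ : S => Multiplicative.ofAdd (1 : ℤ)) (altWord a b m)
      = Multiplicative.ofAdd (1 : ℤ) ^ m := by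
  induction m generalizing a b with
  | zero => simp [altWord]
  | succ k ih => rw [altWord, map_mul, FreeGroup.lift_apply_of, ih, pow_succ']

theorem lift_braidRels {S : Type*} (M : CoxeterMatrix S) :
    ∀ r ∈ braidRels M,
      FreeGroup.lift (fun _ : S => Multiplicative.ofAdd (1 : ℤ)) r = 1 := by
  rintro r ⟨s, t, rfl⟩
  rw [map_mul, map_inv, lift_altWord, lift_altWord, mul_inv_cancel]

/-- The length homomorphism `ℓ : A → ℤ`, sending every standard generator to `1`
(`ℤ` is written multiplicatively). -/
def len {S : Type*} (M : CoxeterMatrix S) : ArtinGroup M →* Multiplicative ℤ :=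
  PresentedGroup.toGroup (lift_braidRels M)

/-- `Tv(H)`: the group of those automorphisms of `H` that are transvections, that is, of the form
`x ↦ x * l x` for a function `l` from `H` to its centre. -/
def Tv (H : Type*) [Group H] : Subgroup (MulAut H) where
  carrier := {α | ∃ l : H → Subgroup.center H, ∀ x, α x = x * (l x : H)}
  one_mem' := ⟨fun _ => 1, fun x => by simp⟩
  mul_mem' := by
    rintro α β ⟨l, hl⟩ ⟨k, hk⟩
    exact ⟨fun x => k x * l (β x), fun x => by
      rw [MulAut.mul_apply, hl (β x), Subgroup.coe_mul, ← mul_assoc, ← hk x]⟩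
  inv_mem' := by
    rintro α ⟨l, hl⟩
    refine ⟨fun x => (l (α⁻¹ x))⁻¹, fun x => ?_⟩
    have h := hl (α⁻¹ x)
    rw [MulAut.apply_inv_self] at h
    rw [Subgroup.coe_inv]
    exact eq_mul_inv_of_mul_eq h.symm

/-- `Aut*(A)`: the group of automorphisms `α` of the Artin group with `ℓ ∘ α = ℓ` (length
preserving) or `ℓ ∘ α = -ℓ` (length reversing). -/
def AutStar {S : Type*} (M : CoxeterMatrix S) : Subgroup (MulAut (ArtinGroup M)) where
  carrier := {α | (∀ x, len M (α x) = len M x) ∨ (∀ x, len M (α x) = (len M x)⁻¹)}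
  one_mem' := Or.inl fun x => rfl
  mul_mem' := by
    rintro α β (hα | hα) (hβ | hβ)
    · exact Or.inl fun x => by rw [MulAut.mul_apply, hα, hβ]
    · exact Or.inr fun x => by rw [MulAut.mul_apply, hα, hβ]
    · exact Or.inr fun x => by rw [MulAut.mul_apply, hα, hβ]
    · exact Or.inl fun x => by rw [MulAut.mul_apply, hα, hβ, inv_inv]
  inv_mem' := by
    rintro α (hα | hα)
    · exact Or.inl fun x => by
        have h := hα (α⁻¹ x)
        rw [MulAut.apply_inv_self] at h
        exact h.symm
    · exact Or.inr fun x => by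
        have h := hα (α⁻¹ x)
        rw [MulAut.apply_inv_self] at h
        rw [h, inv_inv]

/-- `Aut(A)` contains `Tv(A) ⋊ Aut*(A)` as a finite index subgroup: for the conjugation action `φ`
of `Aut*(A)` on `Tv(A)`, the two inclusions into `Aut(A)` extend to an injective homomorphism of
the semidirect product into `Aut(A)`, whose image has finite index. -/
def SemidirectFiniteIndex {S : Type*} (M : CoxeterMatrix S) : Prop :=
  ∃ (φ : AutStar M →* MulAut (Tv (ArtinGroup M)))
    (f : Tv (ArtinGroup M) ⋊[φ] AutStar M →* MulAut (ArtinGroup M)),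
    (∀ (g : AutStar M) (t : Tv (ArtinGroup M)),
      (φ g t : MulAut (ArtinGroup M)) =
        (g : MulAut (ArtinGroup M)) * (t : MulAut (ArtinGroup M)) *
          (g : MulAut (ArtinGroup M))⁻¹) ∧
    (∀ t : Tv (ArtinGroup M), f (SemidirectProduct.inl t) = (t : MulAut (ArtinGroup M))) ∧
    (∀ g : AutStar M, f (SemidirectProduct.inr g) = (g : MulAut (ArtinGroup M))) ∧
    Function.Injective f ∧ f.range.FiniteIndex

/-- The Coxeter matrix of type `I₂(2n)`, for `n ≥ 1`: two generators, with label `2n`.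
(Mathlib's `CoxeterMatrix.I m` has the label `m + 2`.) -/
abbrev evenDihedral (n : ℕ) : CoxeterMatrix (Fin 2) := CoxeterMatrix.I (2 * n - 2)

end ArtinTv

open ArtinTv

/-!
All the Artin groups in question have an infinite cyclic centre, generated by the Garside element
`ζ`, and two classes of generators under odd edges of the Coxeter graph. A homomorphism `χ : A → ℤ`
is given by arbitrary values `a`, `b` on the two classes, and `χ(ζ) = n (a + r b)`, where `(n, r)` is
`(n, 1)` for `I₂(2n)`, `(n, n - 1)` for `B_n` and `(12, 1)` for `F₄` (`CyclicCenter`). The rest is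
formal:

* A transvection has the form `x ↦ x ζ ^ χ(x)`, maps `ζ` to `ζ ^ (1 + χ(ζ))`, and is bijective iff
  `1 + n (a + r b) = ± 1`. For `n ≥ 3` this forces `a = - r b`, and `Tv(A) ≅ ℤ`; for `n = 2`, `r = 1`
  also `a + b = -1` is possible, and these solutions are the reflections of `D_∞`.
* An automorphism `α` maps `ζ` to `ζ` or `ζ⁻¹`, so `ℓ ∘ α` is a homomorphism to `ℤ` with value
  `± ℓ(ζ)` at `ζ`. Transvections with `χ(ζ) = 0` change `ℓ ∘ α` by `ℓ(ζ)` times any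
  homomorphism that vanishes on `ζ`, so `ℓ ∘ α` has finitely many orbits under `Tv(A)`, and `Aut*(A)` is the stabilizer
  of `{ℓ, -ℓ}`. This needs no knowledge of `Aut(A)`.

The centre is found by Garside's method. In the Artin monoid, presented by one relation
`s · C s t = t · C t s` for each pair of generators, every common multiple of `s` and `t` is a
multiple of `s · C s t` (`lcmProperty_of_cube`): along a chain of relations between two words the
property is propagated by a condition on triples of generators, the cube condition, which concerns
the parabolic subgroups of rank three only and is checked by computation. Consequently, once a
central element `D` divisible by all generators is known, the monoid embeds in the Artin group
(`toArtin_injective`), every group element is a power of `D` times a positive element, and a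
nontrivial central positive element is divisible by all generators, as divisibility spreads along
the edges of the Coxeter graph (`gen_dvd_of_edge`). If `D` divides all such elements, the centre is
generated by `D` (`center_eq_zpowers`). In type `B_n` the element `D` is the product of the
Jucys–Murphy elements (`garsideB_dvd`); in type `F₄` it is computed by word reversing.
-/

namespace ArtinTv

/-! ### Monoids with a complemented presentation -/

section Complement

variable {S : Type*} (C : S → S → List S)

/-- One application of a relation `s · C s t = t · C t s` inside a word. -/
inductive ComplStep : List S → List S → Prop
  | intro (u v : List S) (s t : S) :
      ComplStep (u ++ s :: (C s t ++ v)) (u ++ t :: (C t s ++ v))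

/-- The monoid generated by `S` subject to one relation `s · C s t = t · C t s` for each pair of
generators; the word `C s t` is the *complement* of `s` in the common multiple of `s` and `t`. -/
def ComplMonoid : Type _ := Quot (ComplStep C)

namespace ComplMonoid

/-- The element of the monoid represented by a word. -/
def word (u : List S) : ComplMonoid C := Quot.mk _ u

/-- The generators of the monoid. -/
def gen (s : S) : ComplMonoid C := word C [s]

instance : Monoid (ComplMonoid C) where
  mul := Quot.map₂ (· ++ ·)
    (by
      rintro a _ _ ⟨u, v, s, t⟩
      simpa using ComplStep.intro (C := C) (a ++ u) v s t)
    (by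
      rintro _ _ b ⟨u, v, s, t⟩
      simpa using ComplStep.intro (C := C) u (v ++ b) s t)
  one := word C []
  mul_assoc := by
    rintro ⟨a⟩ ⟨b⟩ ⟨c⟩
    exact congrArg (word C) (List.append_assoc a b c)
  one_mul := by
    rintro ⟨a⟩
    rfl
  mul_one := by
    rintro ⟨a⟩
    exact congrArg (word C) (List.append_nil a)

theorem word_nil : word C [] = 1 := rfl

theorem word_append (u v : List S) : word C (u ++ v) = word C u * word C v := rfl

theorem word_cons (s : S) (u : List S) : word C (s :: u) = gen C s * word C u := rfl

theorem word_surjective : Function.Surjective (word C) := Quot.exists_rep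

theorem gen_mul_word (s t : S) :
    gen C s * word C (C s t) = gen C t * word C (C t s) := by
  have h := Quot.sound (ComplStep.intro (C := C) [] [] s t)
  rwa [List.append_nil, List.append_nil] at h

variable {C}

theorem induction_gen {p : ComplMonoid C → Prop} (one : p 1)
    (mul : ∀ s x, p x → p (gen C s * x)) (x : ComplMonoid C) : p x := by
  obtain ⟨u, rfl⟩ := word_surjective C x
  induction u with
  | nil => exact one
  | cons s u ih => exact mul s _ ih

/-- Extension of a map of generators satisfying the relations to a homomorphism. -/
def lift {N : Type*} [Monoid N] (f : S → N)
    (hf : ∀ s t, f s * ((C s t).map f).prod = f t * ((C t s).map f).prod) :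
    ComplMonoid C →* N where
  toFun := Quot.lift (fun u => (u.map f).prod) (by
    rintro _ _ ⟨u, v, s, t⟩
    simp only [List.map_append, List.prod_append, List.map_cons, List.prod_cons]
    rw [← mul_assoc (f s), hf, mul_assoc])
  map_one' := rfl
  map_mul' := by
    rintro ⟨a⟩ ⟨b⟩
    exact (congrArg List.prod (List.map_append (f := f))).trans List.prod_append

theorem lift_gen {N : Type*} [Monoid N] (f : S → N)
    (hf : ∀ s t, f s * ((C s t).map f).prod = f t * ((C t s).map f).prod) (s : S) :
    lift f hf (gen C s) = f s :=
  mul_one (f s)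

theorem lift_word {N : Type*} [Monoid N] (f : S → N)
    (hf : ∀ s t, f s * ((C s t).map f).prod = f t * ((C t s).map f).prod) (u : List S) :
    lift f hf (word C u) = (u.map f).prod := rfl

theorem eq_one_or_gen_dvd (x : ComplMonoid C) : x = 1 ∨ ∃ s y, x = gen C s * y := by
  obtain ⟨u, rfl⟩ := word_surjective C x
  cases u with
  | nil => exact Or.inl rfl
  | cons s u => exact Or.inr ⟨s, word C u, rfl⟩

section Length

variable (hC : ∀ s t, (C s t).length = (C t s).length)
include hC

/-- The length of an element, for a presentation by relations between words of equal length. -/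
def length (x : ComplMonoid C) : ℕ :=
  Quot.lift List.length (by
    rintro _ _ ⟨u, v, s, t⟩
    simp [hC s t]) x

theorem length_word (u : List S) : length hC (word C u) = u.length := rfl

theorem length_mul (x y : ComplMonoid C) :
    length hC (x * y) = length hC x + length hC y := by
  obtain ⟨u, rfl⟩ := word_surjective C x
  obtain ⟨v, rfl⟩ := word_surjective C y
  exact List.length_append

theorem length_gen (s : S) : length hC (gen C s) = 1 := rfl

end Length

end ComplMonoid

/-! ### Word reversing -/

/-- Word reversing: from words `u` and `v`, compute words `(v', u')` with `u · v' = v · u'`, by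
filling a grid whose cells are the relations. The number bounds the depth of the recursion. -/
def wordRev : ℕ → List S → List S → Option (List S × List S)
  | 0, _, _ => none
  | _ + 1, [], v => some (v, [])
  | _ + 1, s :: u, [] => some ([], s :: u)
  | n + 1, s :: u, t :: v =>
    match wordRev n u (C s t) with
    | none => none
    | some (a, b) =>
      match wordRev n v (C t s ++ b) with
      | none => none
      | some (c, d) => some (a ++ d, c)

open ComplMonoid

theorem wordRev_sound {n : ℕ} {u v v' u' : List S} (h : wordRev C n u v = some (v', u')) :
    word C u * word C v' = word C v * word C u' := by
  induction n generalizing u v v' u' with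
  | zero => simp [wordRev] at h
  | succ n ih =>
    match u, v with
    | [], v =>
      simp only [wordRev, Option.some.injEq, Prod.mk.injEq] at h
      obtain ⟨rfl, rfl⟩ := h
      simp [word_nil]
    | s :: u, [] =>
      simp only [wordRev, Option.some.injEq, Prod.mk.injEq] at h
      obtain ⟨rfl, rfl⟩ := h
      simp [word_nil]
    | s :: u, t :: v =>
      cases h1 : wordRev C n u (C s t) with
      | none => simp [wordRev, h1] at h
      | some p =>
        obtain ⟨a, b⟩ := p
        cases h2 : wordRev C n v (C t s ++ b) with
        | none => simp [wordRev, h1, h2] at h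
        | some q =>
          obtain ⟨c, d⟩ := q
          simp only [wordRev, h1, h2, Option.some.injEq, Prod.mk.injEq] at h
          obtain ⟨rfl, rfl⟩ := h
          have e1 := ih h1
          have e2 := ih h2
          rw [word_append] at e2 ⊢
          rw [word_cons, word_cons, mul_assoc, ← mul_assoc (word C u), e1, mul_assoc (gen C t), e2]
          simp only [← mul_assoc]
          rw [gen_mul_word]

theorem word_eq_of_wordRev {n : ℕ} {u v : List S} (h : wordRev C n u v = some ([], [])) :
    word C u = word C v := by
  simpa [word_nil] using wordRev_sound C h

/-! ### The cube condition and least common multiples -/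

variable {C}

/-- Pairs of generators have the least common multiples prescribed by the relations, below
elements whose length is at most `N`. -/
def LcmBelow (hC : ∀ s t, (C s t).length = (C t s).length) (N : ℕ) : Prop :=
  ∀ (s t : S) (x y : ComplMonoid C), length hC x < N → gen C s * x = gen C t * y →
    ∃ z, x = word C (C s t) * z ∧ y = word C (C t s) * z

variable (C) in
/-- Any common multiple of two generators is a multiple of the one given by their relation. For
equal generators with empty complement this is left cancellation. -/
def LcmProperty : Prop :=
  ∀ (s t : S) (x y : ComplMonoid C), gen C s * x = gen C t * y →
    ∃ z, x = word C (C s t) * z ∧ y = word C (C t s) * z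

/-- Reversing computes least common multiples: any common multiple of `u` and `v` is a multiple of
the one found by reversing. -/
theorem LcmBelow.of_wordRev {hC : ∀ s t, (C s t).length = (C t s).length} {N : ℕ}
    (hN : LcmBelow hC N) {n : ℕ} {u v v' u' : List S} (h : wordRev C n u v = some (v', u'))
    {p q : ComplMonoid C} (hlen : u.length + length hC p ≤ N) (hpq : word C u * p = word C v * q) :
    ∃ w, p = word C v' * w ∧ q = word C u' * w := by
  induction n generalizing u v v' u' p q with
  | zero => simp [wordRev] at h
  | succ n ih =>
    match u, v with
    | [], v =>
      simp only [wordRev, Option.some.injEq, Prod.mk.injEq] at h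
      obtain ⟨rfl, rfl⟩ := h
      exact ⟨q, by simpa [word_nil] using hpq, by simp [word_nil]⟩
    | s :: u, [] =>
      simp only [wordRev, Option.some.injEq, Prod.mk.injEq] at h
      obtain ⟨rfl, rfl⟩ := h
      exact ⟨p, by simp [word_nil], by simpa [word_nil] using hpq.symm⟩
    | s :: u, t :: v =>
      cases h1 : wordRev C n u (C s t) with
      | none => simp [wordRev, h1] at h
      | some p =>
        obtain ⟨a, b⟩ := p
        cases h2 : wordRev C n v (C t s ++ b) with
        | none => simp [wordRev, h1, h2] at h
        | some q =>
          obtain ⟨c, d⟩ := q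
          simp only [wordRev, h1, h2, Option.some.injEq, Prod.mk.injEq] at h
          obtain ⟨rfl, rfl⟩ := h
          rename_i p q
          have hl : (word C (t :: v) * q).length hC ≤ N := by
            rw [← hpq, length_mul, length_word]; exact hlen
          rw [length_mul, length_word] at hl
          simp only [List.length_cons] at hl hlen
          rw [word_cons, word_cons, mul_assoc, mul_assoc] at hpq
          obtain ⟨z, hz1, hz2⟩ := hN s t _ _
            (by rw [length_mul, length_word]; omega) hpq
          obtain ⟨w, rfl, rfl⟩ := ih h1 (by omega) hz1
          rw [← mul_assoc, ← word_append] at hz2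
          obtain ⟨w', rfl, rfl⟩ := ih h2 (by omega) hz2
          exact ⟨w', by rw [word_append, mul_assoc], rfl⟩

theorem LcmProperty.of_wordRev (hC : ∀ s t, (C s t).length = (C t s).length)
    (hL : LcmProperty C) {n : ℕ} {u v v' u' : List S} (h : wordRev C n u v = some (v', u'))
    {p q : ComplMonoid C} (hpq : word C u * p = word C v * q) :
    ∃ w, p = word C v' * w ∧ q = word C u' * w :=
  LcmBelow.of_wordRev (hC := hC) (fun s t x y _ hxy => hL s t x y hxy) h le_rfl hpq

variable (C) in
/-- The cube condition for three generators: the common multiple of `r` and `t` obtained by way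
of `s` is a multiple of the one given by the relation between `r` and `t`. It is expressed, and can
be checked, by reversing. -/
def CubeCondition (n : ℕ) (r s t : S) : Prop :=
  ∃ a b e, wordRev C n (C s r) (C s t) = some (a, b) ∧
    wordRev C n (C r s ++ a) (C r t) = some ([], e) ∧
    wordRev C n (C t s ++ b) (C t r ++ e) = some ([], [])

/-- The relation "`u = s · x` and `v = t · y` where `x` and `y` factor through the relation between
`s` and `t`" on nonempty words. -/
def LcmRel (u v : List S) : Prop :=
  match u, v with
  | [], [] => True
  | s :: x, t :: y => ∃ z, word C x = word C (C s t) * z ∧ word C y = word C (C t s) * z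
  | _, _ => False

theorem LcmRel.symm {u v : List S} (h : LcmRel (C := C) u v) : LcmRel (C := C) v u := by
  match u, v with
  | [], [] => trivial
  | s :: x, t :: y =>
    obtain ⟨z, h1, h2⟩ := h
    exact ⟨z, h2, h1⟩

theorem LcmRel.of_tail (h0 : ∀ s, C s s = []) (s : S) {x y : List S} (h : word C x = word C y) :
    LcmRel (C := C) (s :: x) (s :: y) :=
  ⟨word C x, by simp [h0, word_nil], by simp [h0, word_nil, h]⟩

theorem LcmRel.of_step (h0 : ∀ s, C s s = []) {u v : List S} (h : ComplStep C u v) :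
    LcmRel (C := C) u v := by
  obtain ⟨_ | ⟨r, u⟩, v, s, t⟩ := h
  · exact ⟨word C v, rfl, rfl⟩
  · exact LcmRel.of_tail h0 r (Quot.sound (ComplStep.intro u v s t))

/-- The cube condition makes the relation transitive, one length above the lengths for which
least common multiples are known. -/
theorem LcmRel.trans {hC : ∀ s t, (C s t).length = (C t s).length} (h0 : ∀ s, C s s = [])
    {n : ℕ} (hcube : ∀ r s t, r ≠ s → s ≠ t → r ≠ t → CubeCondition C n r s t) {N : ℕ}
    (hN : LcmBelow hC N) {u v w : List S} (hv : v.length ≤ N + 1) (huv : LcmRel (C := C) u v)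
    (hvw : LcmRel (C := C) v w) : LcmRel (C := C) u w := by
  match u, v, w with
  | [], [], [] => trivial
  | r :: x, s :: y, t :: z =>
    obtain ⟨p, hx, hy⟩ := huv
    obtain ⟨q, hy', hz⟩ := hvw
    have hlen : (C s r).length + length hC p ≤ N := by
      have h := congrArg (length hC) hy
      rw [length_mul, length_word, length_word] at h
      simp only [List.length_cons] at hv
      omega
    by_cases hrs : r = s
    · subst hrs
      rw [h0, word_nil, one_mul] at hx hy
      exact ⟨q, by rw [hx, ← hy, hy'], hz⟩
    by_cases hst : s = t
    · subst hst
      rw [h0, word_nil, one_mul] at hz hy'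
      exact ⟨p, hx, by rw [hz, ← hy', hy]⟩
    by_cases hrt : r = t
    · subst hrt
      have hcancel : ∀ u : List S, ∀ p q : ComplMonoid C, u.length + length hC p ≤ N →
          word C u * p = word C u * q → p = q := by
        intro u
        induction u with
        | nil => intro p q _ h; simpa [word_nil] using h
        | cons a u ih =>
          intro p q hl h
          rw [word_cons, mul_assoc, mul_assoc] at h
          simp only [List.length_cons] at hl
          obtain ⟨z, h1, h2⟩ := hN a a _ _ (by rw [length_mul, length_word]; omega) h
          exact ih p q (by omega) (h1.trans h2.symm)
      have hpq := hcancel _ p q hlen (hy.symm.trans hy')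
      exact ⟨word C x, by simp [h0, word_nil], by rw [hz, hx, hpq, h0, word_nil, one_mul]⟩
    obtain ⟨a, b, e, h1, h2, h3⟩ := hcube r s t hrs hst hrt
    -- The three words tested by the cube condition close up the cube over `r`, `s`, `t`.
    obtain ⟨w, rfl, rfl⟩ := hN.of_wordRev h1 hlen (hy.symm.trans hy')
    have e2 := wordRev_sound C h2
    have e3 := wordRev_sound C h3
    rw [word_nil, mul_one, word_append] at e2
    rw [word_nil, mul_one, mul_one, word_append, word_append] at e3
    exact ⟨word C e * w, by rw [hx, ← mul_assoc, e2, mul_assoc],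
      by rw [hz, ← mul_assoc, e3, mul_assoc]⟩

/-- Garside's lemma: a presentation which satisfies the cube condition on generators has left
cancellation and the least common multiples prescribed by its relations. -/
theorem lcmProperty_of_cube (hC : ∀ s t, (C s t).length = (C t s).length) (h0 : ∀ s, C s s = [])
    {n : ℕ} (hcube : ∀ r s t, r ≠ s → s ≠ t → r ≠ t → CubeCondition C n r s t) :
    LcmProperty C := by
  have key : ∀ N, LcmBelow hC N := by
    intro N
    induction N with
    | zero => exact fun s t x y h => absurd h (Nat.not_lt_zero _)
    | succ N ih =>
      intro s t x y hx hxy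
      obtain ⟨x, rfl⟩ := word_surjective C x
      obtain ⟨y, rfl⟩ := word_surjective C y
      have hgen : Relation.EqvGen (ComplStep C) (s :: x) (t :: y) := Quot.eqvGen_exact hxy
      have hrel : ∀ u v, Relation.EqvGen (ComplStep C) u v → u.length ≤ N + 1 →
          LcmRel (C := C) u v := by
        intro u v h
        induction h with
        | rel u v h => exact fun _ => LcmRel.of_step h0 h
        | refl u =>
          intro _
          cases u with
          | nil => trivial
          | cons a u => exact LcmRel.of_tail h0 a rfl
        | symm u v h ihs =>
          intro hl
          refine (ihs ?_).symm
          have := congrArg (length hC) (Quot.eqvGen_sound h)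
          exact (show u.length = v.length from this).trans_le hl
        | trans u v w h1 h2 ih1 ih2 =>
          intro hl
          have : u.length = v.length := congrArg (length hC) (Quot.eqvGen_sound h1)
          exact LcmRel.trans h0 hcube ih (by omega) (ih1 hl) (ih2 (by omega))
      exact hrel _ _ hgen (by rw [length_word] at hx; simpa using hx)
  exact fun s t x y hxy => key _ s t x y (Nat.lt_succ_self (length hC x)) hxy

/-- Reversing is compatible with maps of generators which preserve the complements. -/
theorem wordRev_map {T : Type*} {D : T → T → List T} (f : S → T)
    (hf : ∀ s t, D (f s) (f t) = (C s t).map f) {n : ℕ} {u v v' u' : List S}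
    (h : wordRev C n u v = some (v', u')) :
    wordRev D n (u.map f) (v.map f) = some (v'.map f, u'.map f) := by
  induction n generalizing u v v' u' with
  | zero => simp [wordRev] at h
  | succ n ih =>
    match u, v with
    | [], v =>
      simp only [wordRev, Option.some.injEq, Prod.mk.injEq] at h
      obtain ⟨rfl, rfl⟩ := h
      simp [wordRev]
    | s :: u, [] =>
      simp only [wordRev, Option.some.injEq, Prod.mk.injEq] at h
      obtain ⟨rfl, rfl⟩ := h
      simp [wordRev]
    | s :: u, t :: v =>
      cases h1 : wordRev C n u (C s t) with
      | none => simp [wordRev, h1] at h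
      | some p =>
        obtain ⟨a, b⟩ := p
        cases h2 : wordRev C n v (C t s ++ b) with
        | none => simp [wordRev, h1, h2] at h
        | some q =>
          obtain ⟨c, d⟩ := q
          simp only [wordRev, h1, h2, Option.some.injEq, Prod.mk.injEq] at h
          obtain ⟨rfl, rfl⟩ := h
          have e1 := ih h1
          have e2 := ih h2
          rw [List.map_append] at e2
          simp [wordRev, hf, e1, e2]

theorem CubeCondition.map {T : Type*} {D : T → T → List T} (f : S → T)
    (hf : ∀ s t, D (f s) (f t) = (C s t).map f) {n : ℕ} {r s t : S}
    (h : CubeCondition C n r s t) : CubeCondition D n (f r) (f s) (f t) := by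
  obtain ⟨a, b, e, h1, h2, h3⟩ := h
  refine ⟨a.map f, b.map f, e.map f, ?_, ?_, ?_⟩
  · simpa [hf] using wordRev_map f hf h1
  · simpa [hf] using wordRev_map f hf h2
  · simpa [hf] using wordRev_map f hf h3

theorem LcmProperty.mul_left_cancel (hL : LcmProperty C) (h0 : ∀ s, C s s = [])
    {x y z : ComplMonoid C} (h : x * y = x * z) : y = z := by
  induction x using induction_gen generalizing y z with
  | one => simpa using h
  | mul s x ih =>
    rw [mul_assoc, mul_assoc] at h
    obtain ⟨w, h1, h2⟩ := hL s s _ _ h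
    rw [h0, word_nil, one_mul] at h1 h2
    exact ih (h1.trans h2.symm)

end Complement

open ComplMonoid

/-! ### Artin monoids -/

section Artin

variable {S : Type*}

/-- The alternating word `a b a ...` of length `m` as a list. -/
def altList (a b : S) : ℕ → List S
  | 0 => []
  | m + 1 => a :: altList b a m

theorem length_altList (a b : S) (m : ℕ) : (altList a b m).length = m := by
  induction m generalizing a b with
  | zero => rfl
  | succ m ih => simp [altList, ih]

theorem map_altList {T : Type*} (f : S → T) (a b : S) (m : ℕ) :
    (altList a b m).map f = altList (f a) (f b) m := by
  induction m generalizing a b with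
  | zero => rfl
  | succ m ih => simp [altList, ih]

theorem lift_altWord_eq {G : Type*} [Group G] (f : S → G) (a b : S) (m : ℕ) :
    FreeGroup.lift f (altWord a b m) = ((altList a b m).map f).prod := by
  induction m generalizing a b with
  | zero => simp [altWord, altList]
  | succ m ih => simp [altWord, altList, ih]

/-- The complements of a matrix of finite labels: `s · braidCompl m s t` is the alternating word of
length `m s t` beginning with `s`. The label `0` is excluded by hypotheses where it matters. -/
def braidCompl (m : S → S → ℕ) (s t : S) : List S := altList t s (m s t - 1)

/-- The Artin monoid of a Coxeter matrix without the label `∞`. -/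
abbrev ArtinMonoid (M : CoxeterMatrix S) : Type _ := ComplMonoid (braidCompl (M : S → S → ℕ))

variable (M : CoxeterMatrix S)

theorem length_braidCompl (s t : S) :
    (braidCompl M s t).length = (braidCompl M t s).length := by
  simp only [braidCompl, length_altList, M.symmetric s t]

theorem braidCompl_self (s : S) : braidCompl M s s = [] := by
  simp [braidCompl, altList]

/-- Extension of a map of generators satisfying the braid relations to the Artin group. -/
def artinLift {G : Type*} [Group G] (f : S → G)
    (hf : ∀ s t, ((altList s t (M s t)).map f).prod = ((altList t s (M s t)).map f).prod) :
    ArtinGroup M →* G :=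
  PresentedGroup.toGroup (f := f) (by
    rintro r ⟨s, t, rfl⟩
    rw [map_mul, map_inv, lift_altWord_eq, lift_altWord_eq, hf, mul_inv_cancel])

variable {M}

theorem artinLift_of {G : Type*} [Group G] (f : S → G)
    (hf : ∀ s t, ((altList s t (M s t)).map f).prod = ((altList t s (M s t)).map f).prod) (s : S) :
    artinLift M f hf (PresentedGroup.of s) = f s :=
  PresentedGroup.toGroup.of _

theorem artin_relation (s t : S) :
    ((altList s t (M s t)).map (PresentedGroup.of (rels := braidRels M))).prod =
      ((altList t s (M s t)).map PresentedGroup.of).prod := by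
  have h : FreeGroup.lift (PresentedGroup.of (rels := braidRels M)) = PresentedGroup.mk _ :=
    FreeGroup.ext_hom _ _ fun a => by simp [PresentedGroup.of]
  rw [← lift_altWord_eq, ← lift_altWord_eq, h, ← mul_inv_eq_one, ← map_inv, ← map_mul]
  exact PresentedGroup.one_of_mem ⟨s, t, rfl⟩

theorem cons_braidCompl (hM : ∀ s t, M s t ≠ 0) (s t : S) :
    s :: braidCompl M s t = altList s t (M s t) := by
  obtain ⟨k, hk⟩ := Nat.exists_eq_succ_of_ne_zero (hM s t)
  simp [braidCompl, hk, altList]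

/-- The natural map from the Artin monoid to the Artin group. -/
def toArtin (hM : ∀ s t, M s t ≠ 0) : ArtinMonoid M →* ArtinGroup M :=
  ComplMonoid.lift PresentedGroup.of (by
    intro s t
    have h := artin_relation (M := M) s t
    rwa [← cons_braidCompl hM s t, M.symmetric s t, ← cons_braidCompl hM t s, List.map_cons,
      List.prod_cons, List.map_cons, List.prod_cons] at h)

theorem toArtin_gen (hM : ∀ s t, M s t ≠ 0) (s : S) :
    toArtin hM (gen _ s) = PresentedGroup.of s := lift_gen _ _ _

/-! ### Embedding in the Artin group -/

section Garside

variable (hL : LcmProperty (braidCompl (M : S → S → ℕ))) {D : ArtinMonoid M}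
  (hcomm : ∀ s, Commute (gen _ s) D) (hdvd : ∀ s, ∃ y, D = gen _ s * y)

theorem commute_of_commute_gen {C : S → S → List S} {D : ComplMonoid C}
    (hcomm : ∀ s, Commute (gen C s) D) (x : ComplMonoid C) : Commute x D := by
  induction x using induction_gen with
  | one => exact Commute.one_left _
  | mul s x ih => exact (hcomm s).mul_left ih

include hcomm in
/-- The powers of a central element form an Ore set. -/
abbrev orePowers (hcancel : ∀ x y z : ArtinMonoid M, x * y = x * z → y = z) :
    OreLocalization.OreSet (Submonoid.powers D) where
  ore_right_cancel := by
    rintro x y ⟨_, k, rfl⟩ h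
    have hc := fun z => (commute_of_commute_gen hcomm z).pow_right k
    refine ⟨1, ?_⟩
    have h' : D ^ k * x = D ^ k * y := by rw [← (hc x).eq, ← (hc y).eq]; exact h
    rw [hcancel _ _ _ h']
  oreNum r _ := r
  oreDenom _ s := s
  ore_eq := by
    rintro r ⟨_, k, rfl⟩
    exact ((commute_of_commute_gen hcomm r).pow_right k).eq.symm

include hL hcomm hdvd in
/-- An Artin monoid with least common multiples embeds in the Artin group as soon as some central
element is divisible by all generators: inverting this element makes the generators invertible. -/
theorem toArtin_injective (hM : ∀ s t, M s t ≠ 0) : Function.Injective (toArtin hM) := by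
  have hcancel : ∀ x y z : ArtinMonoid M, x * y = x * z → y = z :=
    fun x y z h => hL.mul_left_cancel (braidCompl_self M) h
  let _ := orePowers hcomm hcancel
  let j : ArtinMonoid M →* OreLocalization (Submonoid.powers D) (ArtinMonoid M) :=
    OreLocalization.numeratorHom
  have hj : Function.Injective j := by
    intro x y hxy
    have hxy' : (x /ₒ (1 : Submonoid.powers D)) = y /ₒ 1 := hxy
    obtain ⟨u, v, h1, h2⟩ := OreLocalization.oreDiv_eq_iff.1 hxy'
    have h2' : (u : ArtinMonoid M) = v := by simpa using h2
    have h1' : (u : ArtinMonoid M) * y = v * x := h1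
    rw [h2'] at h1'
    exact (hcancel _ _ _ h1').symm
  have hunit : ∀ s, IsUnit (j (gen _ s)) := by
    intro s
    obtain ⟨y, hy⟩ := hdvd s
    have hy' : y * gen _ s = D := hcancel (gen _ s) _ _ (by
      rw [← mul_assoc, ← hy, (hcomm s).eq])
    have hD : IsUnit (j D) := OreLocalization.numerator_isUnit
      (⟨D, Submonoid.mem_powers D⟩ : Submonoid.powers D)
    obtain ⟨w, hw⟩ := hD
    refine isUnit_iff_exists_and_exists.2 ⟨⟨j y * ↑w⁻¹, ?_⟩, ⟨↑w⁻¹ * j y, ?_⟩⟩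
    · rw [← mul_assoc, ← map_mul, ← hy, ← hw, Units.mul_inv]
    · rw [mul_assoc, ← map_mul, hy', ← hw, Units.inv_mul]
  let f : S → (OreLocalization (Submonoid.powers D) (ArtinMonoid M))ˣ := fun s => (hunit s).unit
  have hf : ∀ u : List S, ((u.map f).prod : OreLocalization (Submonoid.powers D) (ArtinMonoid M))
      = j (word _ u) := by
    intro u
    induction u with
    | nil => simp [word_nil]
    | cons s u ih => rw [List.map_cons, List.prod_cons, Units.val_mul, ih, word_cons, map_mul]; rfl
  let F : ArtinGroup M →* (OreLocalization (Submonoid.powers D) (ArtinMonoid M))ˣ :=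
    artinLift M f (by
      intro s t
      ext
      rw [hf, hf, ← cons_braidCompl hM s t, M.symmetric s t, ← cons_braidCompl hM t s, word_cons,
        word_cons, gen_mul_word])
  have hF : ∀ x, (F (toArtin hM x) : OreLocalization (Submonoid.powers D) (ArtinMonoid M)) = j x := by
    intro x
    induction x using induction_gen with
    | one => simp
    | mul s x ih =>
      rw [map_mul, map_mul, Units.val_mul, ih, map_mul, toArtin_gen]
      congr 1
      exact congrArg Units.val (artinLift_of f _ s)
  intro x y hxy
  apply hj
  rw [← hF, ← hF, hxy]

include hcomm in
theorem commute_toArtin (hM : ∀ s t, M s t ≠ 0) (g : ArtinGroup M) :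
    Commute g (toArtin hM D) := by
  have : (⊤ : Subgroup (ArtinGroup M)) ≤ Subgroup.centralizer {toArtin hM D} := by
    rw [← PresentedGroup.closure_range_of, Subgroup.closure_le]
    rintro _ ⟨s, rfl⟩
    rw [SetLike.mem_coe, Subgroup.mem_centralizer_singleton_iff, ← toArtin_gen hM, ← map_mul,
      ← map_mul, (hcomm s).eq]
  exact Subgroup.mem_centralizer_singleton_iff.1 (this (Subgroup.mem_top g))

include hcomm hdvd in
/-- Every element of the Artin group becomes positive after multiplication by a power of a central
element divisible by all generators. -/
theorem exists_pow_mul_eq (hM : ∀ s t, M s t ≠ 0) (g : ArtinGroup M) :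
    ∃ (k : ℕ) (x : ArtinMonoid M), toArtin hM D ^ k * g = toArtin hM x := by
  have hD := fun y => (commute_toArtin hcomm hM y).eq.symm
  have hg : g ∈ Subgroup.closure (Set.range (PresentedGroup.of (rels := braidRels M))) := by
    rw [PresentedGroup.closure_range_of]; exact Subgroup.mem_top g
  induction hg using Subgroup.closure_induction_left with
  | one => exact ⟨0, 1, by simp⟩
  | mul_left s hs g _ ih =>
    obtain ⟨s, rfl⟩ := hs
    obtain ⟨k, x, hx⟩ := ih
    refine ⟨k, gen _ s * x, ?_⟩
    have hk : toArtin hM D ^ k * PresentedGroup.of s = PresentedGroup.of s * toArtin hM D ^ k :=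
      Commute.pow_left (hD _) k
    rw [← mul_assoc, hk, mul_assoc, hx, map_mul, toArtin_gen]
  | inv_mul_cancel s hs g _ ih =>
    obtain ⟨s, rfl⟩ := hs
    obtain ⟨k, x, hx⟩ := ih
    obtain ⟨y, hy⟩ := hdvd s
    refine ⟨k + 1, y * x, ?_⟩
    have hk : toArtin hM D ^ k * (PresentedGroup.of s)⁻¹ =
        (PresentedGroup.of s)⁻¹ * toArtin hM D ^ k := Commute.pow_left (hD _) k
    have h1 : toArtin hM D * (PresentedGroup.of s)⁻¹ = toArtin hM y := by
      rw [hD, hy, map_mul, toArtin_gen, inv_mul_cancel_left]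
    rw [pow_succ', mul_assoc, ← mul_assoc _ _ g, hk, mul_assoc, hx, ← mul_assoc, h1, map_mul]

/-! ### The centre -/

include hL in
/-- If a central element begins with `s`, then it begins with every neighbour of `s` in the Coxeter
graph. -/
theorem gen_dvd_of_edge {x : ArtinMonoid M} (hx : ∀ s, Commute (gen _ s) x) {s t : S}
    (hst : 3 ≤ M s t) (hs : ∃ y, x = gen _ s * y) : ∃ y, x = gen _ t * y := by
  obtain ⟨b, rfl⟩ := hs
  have h1 : gen _ s * (b * gen _ t) = gen _ t * (gen _ s * b) := by
    rw [← mul_assoc, (hx t).eq]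
  obtain ⟨z, -, h2⟩ := hL s t _ _ h1
  obtain ⟨k, hk⟩ : ∃ k, M t s - 1 = k + 2 := ⟨M t s - 3, by rw [M.symmetric t s]; omega⟩
  simp only [braidCompl, hk, altList, word_cons, mul_assoc] at h2
  have h3 := hL.mul_left_cancel (braidCompl_self M) h2
  refine ⟨word _ (altList s t k) * z * gen _ s, ?_⟩
  have hbs : gen _ s * b = b * gen _ s := by
    refine hL.mul_left_cancel (braidCompl_self M) (x := gen _ s) ?_
    rw [(hx s).eq, mul_assoc]
  rw [hbs, h3]
  simp only [mul_assoc]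

include hL hcomm in
/-- If the Coxeter graph is connected and `D` divides all central elements which are divisible by
all generators, then every central element of the monoid is a power of `D`. -/
theorem central_eq_pow (hdvd : ∀ s, ∃ y, D = gen _ s * y)
    (hconn : ∀ p : S → Prop, (∀ s t, p s → 3 ≤ M s t → p t) → (∃ s, p s) → ∀ t, p t)
    (hD : ∀ x : ArtinMonoid M, (∀ s, Commute (gen _ s) x) → (∀ s, ∃ y, x = gen _ s * y) →
      ∃ y, x = D * y)
    (x : ArtinMonoid M) (hx : ∀ s, Commute (gen _ s) x) : ∃ k : ℕ, x = D ^ k := by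
  induction hl : x.length (length_braidCompl M) using Nat.strong_induction_on generalizing x with
  | _ l ih =>
    rcases eq_one_or_gen_dvd x with rfl | ⟨s, y, hy⟩
    · exact ⟨0, by simp⟩
    · obtain ⟨z, hz⟩ := hD x hx (hconn (fun s => ∃ y, x = gen _ s * y)
        (fun s t hs hst => gen_dvd_of_edge hL hx hst hs) ⟨s, y, hy⟩)
      obtain ⟨w, hw⟩ := hdvd s
      have hlt : z.length (length_braidCompl M) < l := by
        rw [← hl, hz, hw, length_mul, length_mul, length_gen]
        omega
      obtain ⟨k, hk⟩ := ih _ hlt z (fun t => by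
        refine hL.mul_left_cancel (braidCompl_self M) (x := D) ?_
        rw [← mul_assoc, ← (hcomm t).eq, mul_assoc, ← hz, (hx t).eq, hz, mul_assoc]) rfl
      exact ⟨k + 1, by rw [hz, hk, pow_succ']⟩

include hL hcomm in
/-- The centre of the Artin group is generated by a central positive element `D` which is divisible
by all generators and divides all central positive elements with this property. -/
theorem center_eq_zpowers (hM : ∀ s t, M s t ≠ 0) (hdvd : ∀ s, ∃ y, D = gen _ s * y)
    (hconn : ∀ p : S → Prop, (∀ s t, p s → 3 ≤ M s t → p t) → (∃ s, p s) → ∀ t, p t)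
    (hD : ∀ x : ArtinMonoid M, (∀ s, Commute (gen _ s) x) → (∀ s, ∃ y, x = gen _ s * y) →
      ∃ y, x = D * y) :
    Subgroup.center (ArtinGroup M) = Subgroup.zpowers (toArtin hM D) := by
  have hinj := toArtin_injective hL hcomm hdvd hM
  apply le_antisymm
  · intro g hg
    obtain ⟨k, x, hx⟩ := exists_pow_mul_eq hcomm hdvd hM g
    have hDc : toArtin hM D ∈ Subgroup.zpowers (toArtin hM D) := Subgroup.mem_zpowers _
    rw [Subgroup.mem_center_iff] at hg
    obtain ⟨l, rfl⟩ := central_eq_pow hL hcomm hdvd hconn hD x (fun s => hinj (by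
      have h1 : toArtin hM (gen _ s) * toArtin hM D ^ k = toArtin hM D ^ k * toArtin hM (gen _ s) := by
        rw [← map_pow, ← map_mul, ← map_mul, ((hcomm s).pow_right k).eq]
      rw [map_mul, map_mul, ← hx, ← mul_assoc, h1, mul_assoc, hg, mul_assoc]))
    have : g = (toArtin hM D ^ k)⁻¹ * toArtin hM D ^ l := by
      rw [eq_inv_mul_iff_mul_eq, hx, map_pow]
    rw [this]
    exact mul_mem (inv_mem (pow_mem hDc _)) (pow_mem hDc _)
  · rw [Subgroup.zpowers_le, Subgroup.mem_center_iff]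
    exact fun g => (commute_toArtin hcomm hM g).eq

end Garside

end Artin

/-! ### The Garside element in type `B` -/

/-- Elements `σ 0, ..., σ N` of a left cancellative monoid which satisfy the braid relations of type
`B`, with the label `4` between `σ 0` and `σ 1`, and have the least common multiples prescribed
by these relations. -/
structure BRelations {G : Type*} [Monoid G] (σ : ℕ → G) (N : ℕ) : Prop where
  cancel : ∀ x y z : G, x * y = x * z → y = z
  comm : ∀ i j, i + 1 < j → j ≤ N → Commute (σ i) (σ j)
  braid : ∀ i, 1 ≤ i → i + 1 ≤ N → σ i * (σ (i + 1) * σ i) = σ (i + 1) * (σ i * σ (i + 1))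
  quad : 1 ≤ N → σ 0 * (σ 1 * (σ 0 * σ 1)) = σ 1 * (σ 0 * (σ 1 * σ 0))
  lcm_comm : ∀ i j x y, i + 1 < j → j ≤ N → σ i * x = σ j * y → ∃ z, x = σ j * z
  lcm_braid : ∀ i x y, 1 ≤ i → i + 1 ≤ N → σ i * x = σ (i + 1) * y →
    ∃ z, x = σ (i + 1) * (σ i * z) ∧ y = σ i * (σ (i + 1) * z)
  lcm_quad : ∀ x y, 1 ≤ N → σ 0 * x = σ 1 * y →
    ∃ z, x = σ 1 * (σ 0 * (σ 1 * z)) ∧ y = σ 0 * (σ 1 * (σ 0 * z))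

section TypeB

variable {G : Type*} [Monoid G]

/-- The Jucys–Murphy elements `σ k ⋯ σ 1 σ 0 σ 1 ⋯ σ k` of the Artin monoid of type `B`. -/
def jucysMurphy (σ : ℕ → G) : ℕ → G
  | 0 => σ 0
  | k + 1 => σ (k + 1) * (jucysMurphy σ k * σ (k + 1))

/-- The Garside element of type `B`, as the product of the Jucys–Murphy elements. -/
def garsideB (σ : ℕ → G) : ℕ → G
  | 0 => σ 0
  | k + 1 => garsideB σ k * jucysMurphy σ (k + 1)

variable {σ : ℕ → G} {N : ℕ} (h : BRelations σ N)
include h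

theorem commute_jucysMurphy_of_lt {i j : ℕ} (hij : i + 1 < j) (hj : j ≤ N) :
    Commute (jucysMurphy σ i) (σ j) := by
  induction i with
  | zero => exact h.comm 0 j hij hj
  | succ i ih =>
    exact (h.comm (i + 1) j hij hj).mul_left ((ih (by omega)).mul_left (h.comm (i + 1) j hij hj))

theorem commute_jucysMurphy_of_gt {i j : ℕ} (hij : j < i) (hi : i ≤ N) :
    Commute (σ j) (jucysMurphy σ i) := by
  induction i generalizing j with
  | zero => omega
  | succ i ih =>
    rcases Nat.lt_succ_iff_lt_or_eq.1 hij with hlt | rfl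
    · have h1 := h.comm j (i + 1) (by omega) hi
      exact h1.mul_right ((ih hlt (by omega)).mul_right h1)
    · cases j with
      | zero =>
        have := h.quad hi
        simpa [Commute, SemiconjBy, jucysMurphy, mul_assoc] using this
      | succ j =>
        have hb := h.braid (j + 1) (by omega) hi
        have hc := commute_jucysMurphy_of_lt h (show j + 1 < j + 1 + 1 by omega) hi
        rw [Commute, SemiconjBy]
        simp only [jucysMurphy]
        calc σ (j + 1) * (σ (j + 1 + 1) * (σ (j + 1) * (jucysMurphy σ j * σ (j + 1)) *
                σ (j + 1 + 1)))
            = σ (j + 1) * (σ (j + 1 + 1) * σ (j + 1)) * (jucysMurphy σ j * σ (j + 1) *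
                σ (j + 1 + 1)) := by simp only [mul_assoc]
          _ = σ (j + 1 + 1) * σ (j + 1) * (σ (j + 1 + 1) * jucysMurphy σ j) *
                (σ (j + 1) * σ (j + 1 + 1)) := by rw [hb]; simp only [mul_assoc]
          _ = σ (j + 1 + 1) * σ (j + 1) * jucysMurphy σ j * (σ (j + 1 + 1) *
                (σ (j + 1) * σ (j + 1 + 1))) := by rw [← hc.eq]; simp only [mul_assoc]
          _ = _ := by rw [← hb]; simp only [mul_assoc]

theorem commute_jucysMurphy_jucysMurphy {i j : ℕ} (hij : i < j) (hj : j ≤ N) :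
    Commute (jucysMurphy σ i) (jucysMurphy σ j) := by
  induction i with
  | zero => exact commute_jucysMurphy_of_gt h hij hj
  | succ i ih =>
    have h1 := commute_jucysMurphy_of_gt h hij hj
    exact h1.mul_left ((ih (by omega)).mul_left h1)

theorem commute_garsideB_of_lt {i j : ℕ} (hij : i + 1 < j) (hj : j ≤ N) :
    Commute (garsideB σ i) (σ j) := by
  induction i with
  | zero => exact h.comm 0 j hij hj
  | succ i ih => exact (ih (by omega)).mul_left (commute_jucysMurphy_of_lt h hij hj)

theorem commute_garsideB_jucysMurphy {i j : ℕ} (hij : i < j) (hj : j ≤ N) :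
    Commute (garsideB σ i) (jucysMurphy σ j) := by
  induction i with
  | zero => exact commute_jucysMurphy_of_gt h hij hj
  | succ i ih => exact (ih (by omega)).mul_left (commute_jucysMurphy_jucysMurphy h hij hj)

theorem commute_garsideB {k j : ℕ} (hj : j ≤ k) (hk : k ≤ N) : Commute (σ j) (garsideB σ k) := by
  induction k generalizing j with
  | zero =>
    obtain rfl : j = 0 := by omega
    exact Commute.refl _
  | succ k ih =>
    rcases Nat.le_succ_iff_eq_or_le.1 hj with rfl | hlt
    swap
    · exact (ih hlt (by omega)).mul_right (commute_jucysMurphy_of_gt h (by omega) hk)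
    have h1 : σ (k + 1) * (jucysMurphy σ k * jucysMurphy σ (k + 1)) =
        jucysMurphy σ k * jucysMurphy σ (k + 1) * σ (k + 1) := by
      have h2 := (commute_jucysMurphy_jucysMurphy h (Nat.lt_succ_self k) hk).eq
      have h3 : σ (k + 1) * (jucysMurphy σ k * jucysMurphy σ (k + 1)) =
          jucysMurphy σ (k + 1) * (jucysMurphy σ k * σ (k + 1)) := by
        simp only [jucysMurphy, mul_assoc]
      rw [h3, ← mul_assoc, ← h2]
    cases k with
    | zero => exact h1
    | succ k =>
      have h2 := commute_garsideB_of_lt h (show k + 1 < k + 1 + 1 by omega) hk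
      rw [Commute, SemiconjBy]
      simp only [garsideB]
      rw [mul_assoc, ← mul_assoc, ← h2.eq, mul_assoc, h1]
      simp only [mul_assoc]

theorem dvd_garsideB {k j : ℕ} (hj : j ≤ k) (hk : k ≤ N) : ∃ y, garsideB σ k = σ j * y := by
  induction k with
  | zero =>
    obtain rfl : j = 0 := by omega
    exact ⟨1, (mul_one _).symm⟩
  | succ k ih =>
    rcases Nat.le_succ_iff_eq_or_le.1 hj with rfl | hlt
    · refine ⟨jucysMurphy σ k * σ (k + 1) * garsideB σ k, ?_⟩
      rw [garsideB, (commute_garsideB_jucysMurphy h (Nat.lt_succ_self k) hk).eq, jucysMurphy]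
      simp only [mul_assoc]
    · obtain ⟨y, hy⟩ := ih hlt (by omega)
      exact ⟨y * jucysMurphy σ (k + 1), by rw [garsideB, hy, mul_assoc]⟩

theorem dvd_of_dvd_jucysMurphy_mul {i j : ℕ} (hij : i + 1 < j) (hj : j ≤ N) {x y : G}
    (hxy : jucysMurphy σ i * x = σ j * y) : ∃ z, x = σ j * z := by
  induction i generalizing x y with
  | zero => exact h.lcm_comm 0 j x y hij hj hxy
  | succ i ih =>
    rw [jucysMurphy, mul_assoc, mul_assoc] at hxy
    obtain ⟨z, hz⟩ := h.lcm_comm _ j _ _ hij hj hxy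
    obtain ⟨w, hw⟩ := ih (by omega) hz
    exact h.lcm_comm _ j _ _ hij hj hw

theorem dvd_of_dvd_garsideB_mul {i j : ℕ} (hij : i + 1 < j) (hj : j ≤ N) {x y : G}
    (hxy : garsideB σ i * x = σ j * y) : ∃ z, x = σ j * z := by
  induction i generalizing x y with
  | zero => exact h.lcm_comm 0 j x y hij hj hxy
  | succ i ih =>
    rw [garsideB, mul_assoc] at hxy
    obtain ⟨z, hz⟩ := ih (by omega) hxy
    exact dvd_of_dvd_jucysMurphy_mul h hij hj hz

theorem dvd_of_dvd_garsideB_mul_succ {k : ℕ} (hk : k + 1 ≤ N) {x y : G}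
    (hxy : garsideB σ k * x = σ (k + 1) * y) : ∃ z, x = σ (k + 1) * z := by
  cases k with
  | zero =>
    obtain ⟨z, hz, -⟩ := h.lcm_quad _ _ hk hxy
    exact ⟨_, hz⟩
  | succ k =>
    rw [garsideB, mul_assoc] at hxy
    obtain ⟨z, hz⟩ := dvd_of_dvd_garsideB_mul h (by omega) hk hxy
    rw [jucysMurphy, mul_assoc, mul_assoc] at hz
    obtain ⟨w, hw, -⟩ := h.lcm_braid _ _ _ (by omega) hk hz
    obtain ⟨v, hv⟩ := dvd_of_dvd_jucysMurphy_mul h (by omega) hk hw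
    obtain ⟨u, hu, -⟩ := h.lcm_braid _ _ _ (by omega) hk hv
    exact ⟨_, hu⟩

/-- An element which begins with `σ (k + 1)` and commutes with `σ 0, ..., σ k` begins with a whole
Jucys–Murphy element. -/
theorem jucysMurphy_dvd {k : ℕ} (hk : k + 1 ≤ N) {b : G} (hb : ∀ i ≤ k, Commute (σ i) b)
    (hdvd : ∃ c, b = σ (k + 1) * c) : ∃ z, b = jucysMurphy σ (k + 1) * z := by
  induction k generalizing b with
  | zero =>
    obtain ⟨c, rfl⟩ := hdvd
    have h1 : σ 0 * (σ 1 * c) = σ 1 * (c * σ 0) := by rw [(hb 0 le_rfl).eq, mul_assoc]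
    obtain ⟨z, hz, -⟩ := h.lcm_quad _ _ hk h1
    refine ⟨z, ?_⟩
    simp only [jucysMurphy, mul_assoc, hz]
  | succ k ih =>
    obtain ⟨c, rfl⟩ := hdvd
    have hbr := h.braid (k + 1) (by omega) hk
    have hc : ∀ i ≤ k, Commute (σ i) c := fun i hi => by
      refine h.cancel (σ (k + 1 + 1)) _ _ ?_
      rw [← mul_assoc, ← (h.comm i (k + 1 + 1) (by omega) hk).eq, mul_assoc, (hb i (by omega)).eq,
        mul_assoc]
    have h1 := (hb (k + 1) le_rfl).eq
    rw [mul_assoc] at h1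
    obtain ⟨z, hz, -⟩ := h.lcm_braid _ _ _ (by omega) hk h1
    obtain ⟨d, rfl⟩ := ih (by omega) hc ⟨z, h.cancel _ _ _ hz⟩
    have hcomm := commute_jucysMurphy_of_lt h (show k + 1 < k + 1 + 1 by omega) hk
    -- Both sides of `h1` begin with `σ (k + 2) σ (k + 1) y`, where `y` is the Jucys–Murphy
    -- element with index `k`.
    have h2 : σ (k + 1 + 1) * (σ (k + 1) * d) = σ (k + 1) * (d * σ (k + 1)) := by
      refine h.cancel (σ (k + 1 + 1) * σ (k + 1) * jucysMurphy σ k) _ _ ?_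
      calc σ (k + 1 + 1) * σ (k + 1) * jucysMurphy σ k * (σ (k + 1 + 1) * (σ (k + 1) * d))
          = σ (k + 1 + 1) * σ (k + 1) * (jucysMurphy σ k * σ (k + 1 + 1)) * (σ (k + 1) * d) := by
            simp only [mul_assoc]
        _ = σ (k + 1 + 1) * (σ (k + 1) * σ (k + 1 + 1)) * (jucysMurphy σ k * (σ (k + 1) * d)) := by
            rw [hcomm.eq]; simp only [mul_assoc]
        _ = σ (k + 1) * (σ (k + 1 + 1) * (jucysMurphy σ (k + 1) * d)) := by
            rw [← hbr]; simp only [jucysMurphy, mul_assoc]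
        _ = _ := by rw [h1]; simp only [jucysMurphy, mul_assoc]
    obtain ⟨v, -, hv⟩ := h.lcm_braid _ _ _ (by omega) hk h2.symm
    refine ⟨v, ?_⟩
    rw [h.cancel _ _ _ hv]
    simp only [jucysMurphy, mul_assoc]

/-- The Garside element of type `B` divides every central element that is divisible by all
generators. -/
theorem garsideB_dvd {k : ℕ} (hk : k ≤ N) {a : G} (ha : ∀ i ≤ k, Commute (σ i) a)
    (hdvd : ∀ i ≤ k, ∃ c, a = σ i * c) : ∃ z, a = garsideB σ k * z := by
  induction k with
  | zero => exact hdvd 0 le_rfl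
  | succ k ih =>
    obtain ⟨b, rfl⟩ := ih (by omega) (fun i hi => ha i (by omega)) (fun i hi => hdvd i (by omega))
    obtain ⟨c, hc⟩ := hdvd (k + 1) le_rfl
    obtain ⟨z, hz⟩ := jucysMurphy_dvd h hk (b := b) (fun i hi => by
      refine h.cancel (garsideB σ k) _ _ ?_
      rw [← mul_assoc, ← (commute_garsideB h hi (by omega)).eq, mul_assoc, (ha i (by omega)).eq,
        mul_assoc]) (dvd_of_dvd_garsideB_mul_succ h hk hc)
    exact ⟨z, by rw [hz, garsideB, mul_assoc]⟩

end TypeB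

/-! ### Homomorphisms to the integers -/

section Hom

variable {S : Type*}

theorem prod_altList {G : Type*} [CommMonoid G] (f : S → G) (s t : S) (m : ℕ) :
    ((altList s t m).map f).prod = f s ^ ((m + 1) / 2) * f t ^ (m / 2) := by
  induction m generalizing s t with
  | zero => simp [altList]
  | succ m ih =>
    rw [altList, List.map_cons, List.prod_cons, ih, show (m + 1 + 1) / 2 = m / 2 + 1 by omega,
      pow_succ']
    rw [mul_assoc, mul_comm (f t ^ _)]

/-- A homomorphism to a commutative group takes equal values on generators joined by an edge of
the Coxeter graph with an odd label. -/
theorem hom_eq_of_odd {M : CoxeterMatrix S} {G : Type*} [CommGroup G] (χ : ArtinGroup M →* G)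
    {s t : S} (hst : Odd (M s t)) : χ (PresentedGroup.of s) = χ (PresentedGroup.of t) := by
  have h := congrArg χ (artin_relation (M := M) s t)
  rw [map_list_prod, map_list_prod, List.map_map, List.map_map, prod_altList, prod_altList] at h
  obtain ⟨k, hk⟩ := hst
  rw [hk, show (2 * k + 1 + 1) / 2 = k + 1 by omega, show (2 * k + 1) / 2 = k by omega, pow_succ,
    pow_succ, mul_assoc, mul_assoc, mul_comm (_ ^ k) (_ * _)] at h
  simp only [Function.comp_apply] at h
  rw [mul_comm (χ (PresentedGroup.of t) ^ k), mul_assoc, mul_assoc,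
    mul_comm (χ (PresentedGroup.of s) ^ k)] at h
  exact mul_right_cancel h

/-- Conversely, generators may be sent to any values which agree along edges with odd labels. -/
theorem exists_hom (M : CoxeterMatrix S) {G : Type*} [CommGroup G] (f : S → G)
    (hf : ∀ s t, Odd (M s t) → f s = f t) :
    ∃ χ : ArtinGroup M →* G, ∀ s, χ (PresentedGroup.of s) = f s := by
  refine ⟨artinLift M f fun s t => ?_, artinLift_of f _⟩
  rw [prod_altList, prod_altList]
  rcases Nat.even_or_odd (M s t) with ⟨k, hk⟩ | h
  · rw [hk, show (k + k + 1) / 2 = k by omega, show (k + k) / 2 = k by omega, mul_comm]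
  · rw [hf s t h]

theorem hom_toArtin_word {M : CoxeterMatrix S} (hM : ∀ s t, M s t ≠ 0) {G : Type*} [CommGroup G]
    (χ : ArtinGroup M →* G) (u : List S) :
    χ (toArtin hM (word _ u)) = (u.map fun s => χ (PresentedGroup.of s)).prod := by
  rw [toArtin, lift_word, map_list_prod, List.map_map]
  rfl

/-- The Artin group has cyclic centre with a generator `ζ`, and its generators fall into two
classes under odd edges, represented by `s` and `t`; every homomorphism `χ` to `ℤ` is determined by
its arbitrary values on `s` and `t`, and the image of `ζ` is `n (χ s + r χ t)`
(written multiplicatively). -/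
def CyclicCenter (M : CoxeterMatrix S) (n r : ℕ) : Prop :=
  ∃ (ζ : ArtinGroup M) (s t : S), Subgroup.center (ArtinGroup M) = Subgroup.zpowers ζ ∧
    (∀ χ : ArtinGroup M →* Multiplicative ℤ,
      χ ζ = (χ (PresentedGroup.of s) * χ (PresentedGroup.of t) ^ r) ^ n) ∧
    (∀ χ ψ : ArtinGroup M →* Multiplicative ℤ, χ (PresentedGroup.of s) = ψ (PresentedGroup.of s) →
      χ (PresentedGroup.of t) = ψ (PresentedGroup.of t) → χ = ψ) ∧
    ∀ a b : Multiplicative ℤ, ∃ χ : ArtinGroup M →* Multiplicative ℤ,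
      χ (PresentedGroup.of s) = a ∧ χ (PresentedGroup.of t) = b

end Hom

/-! ### Even dihedral type -/

theorem altList_append_self {S : Type*} (a b : S) (k : ℕ) :
    altList a b (2 * k) ++ [a] = a :: altList b a (2 * k) := by
  induction k with
  | zero => rfl
  | succ k ih =>
    change a :: b :: (altList a b (2 * k) ++ [a]) = _
    rw [ih]
    rfl

theorem evenDihedral_apply {n : ℕ} (hn : 1 ≤ n) {i j : Fin 2} (hij : i ≠ j) :
    evenDihedral n i j = 2 * n := by
  change (if i = j then 1 else 2 * n - 2 + 2) = 2 * n
  rw [if_neg hij]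
  omega

/-- The central element is the alternating word of length `2n`, which is the common multiple of the
two generators given by their relation. -/
theorem cyclicCenter_evenDihedral {n : ℕ} (hn : 2 ≤ n) : CyclicCenter (evenDihedral n) n 1 := by
  have h01 : evenDihedral n 0 1 = 2 * n := evenDihedral_apply (by omega) (by decide)
  have h10 : evenDihedral n 1 0 = 2 * n := evenDihedral_apply (by omega) (by decide)
  have hM : ∀ s t, evenDihedral n s t ≠ 0 := by
    intro s t
    by_cases h : s = t
    · simp [h]
    · rw [evenDihedral_apply (by omega) h]; omega
  -- There are no three distinct generators.
  have hL : LcmProperty (braidCompl (evenDihedral n)) :=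
    lcmProperty_of_cube (n := 0) (length_braidCompl _) (braidCompl_self _) (by
      intro r s t h1 h2 h3
      omega)
  let D : ArtinMonoid (evenDihedral n) := word _ (altList 0 1 (2 * n))
  have hw0 : D = gen _ 0 * word _ (braidCompl (evenDihedral n) 0 1) := by
    rw [← word_cons, cons_braidCompl hM, h01]
  have hw1 : D = gen _ 1 * word _ (braidCompl (evenDihedral n) 1 0) := by
    rw [hw0, gen_mul_word]
  have hD1 : D = word _ (altList 1 0 (2 * n)) := by
    rw [hw1, ← word_cons, cons_braidCompl hM, h10]
  have hcomm : ∀ s, Commute (gen _ s) D := by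
    intro s
    have hs : s = 0 ∨ s = 1 := by omega
    rcases hs with rfl | rfl
    · change gen _ 0 * D = D * word _ [0]
      rw [hD1, ← word_cons, ← altList_append_self, word_append, ← hD1]
    · change gen _ 1 * D = D * word _ [1]
      rw [← word_cons, ← altList_append_self, word_append, ← hD1]
  have hdvd : ∀ s, ∃ y, D = gen _ s * y := by
    intro s
    have hs : s = 0 ∨ s = 1 := by omega
    rcases hs with rfl | rfl
    · exact ⟨_, hw0⟩
    · exact ⟨_, hw1⟩
  refine ⟨toArtin hM D, 0, 1, center_eq_zpowers hL hcomm hM hdvd ?_ ?_, ?_, ?_, ?_⟩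
  · rintro p hp ⟨s, hs⟩ t
    by_cases hst : s = t
    · exact hst ▸ hs
    · exact hp s t hs (by rw [evenDihedral_apply (by omega) hst]; omega)
  · intro x _ hx
    obtain ⟨y, hy⟩ := hx 0
    obtain ⟨z, hz⟩ := hx 1
    obtain ⟨w, hw, -⟩ := hL 0 1 y z (hy.symm.trans hz)
    exact ⟨w, by rw [hw0, mul_assoc, ← hw, ← hy]⟩
  · intro χ
    rw [hom_toArtin_word, prod_altList, show (2 * n + 1) / 2 = n by omega,
      show 2 * n / 2 = n by omega, pow_one, mul_pow]
  · intro χ ψ h0 h1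
    refine PresentedGroup.ext fun s => ?_
    have hs : s = 0 ∨ s = 1 := by omega
    rcases hs with rfl | rfl
    · exact h0
    · exact h1
  · intro a b
    obtain ⟨χ, hχ⟩ := exists_hom (evenDihedral n) (fun s : Fin 2 => if s = 0 then a else b) (by
      intro s t hst
      by_cases h : s = t
      · rw [h]
      · rw [evenDihedral_apply (by omega) h] at hst
        exact absurd hst (by simp))
    exact ⟨χ, by rw [hχ]; rfl, by rw [hχ]; rfl⟩

/-! ### The cube condition in finite types of rank three -/

/-- The test of the cube condition as a computation. -/
def cubeTest {S : Type*} (C : S → S → List S) (n : ℕ) (r s t : S) : Bool :=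
  match wordRev C n (C s r) (C s t) with
  | none => false
  | some (a, b) =>
    match wordRev C n (C r s ++ a) (C r t) with
    | some ([], e) =>
      match wordRev C n (C t s ++ b) (C t r ++ e) with
      | some ([], []) => true
      | _ => false
    | _ => false

theorem cubeCondition_of_cubeTest {S : Type*} {C : S → S → List S} {n : ℕ} {r s t : S}
    (h : cubeTest C n r s t = true) : CubeCondition C n r s t := by
  unfold cubeTest at h
  split at h
  · simp at h
  · rename_i a b h1
    split at h
    · rename_i e h2
      split at h
      · rename_i h3
        exact ⟨a, b, e, h1, h2, h3⟩
      · simp at h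
    · simp at h

/-- The Coxeter matrix on three generators with given off-diagonal labels. -/
def tripleLabels (x y z : ℕ) (i j : Fin 3) : ℕ :=
  match i, j with
  | 0, 1 | 1, 0 => x
  | 0, 2 | 2, 0 => y
  | 1, 2 | 2, 1 => z
  | _, _ => 1

/-- The cube condition in the types `A₃`, `B₃`, `A₂ × A₁`, `B₂ × A₁` and `A₁ × A₁ × A₁`, for all
orders of the generators. -/
theorem cubeTest_tripleLabels : ∀ x ∈ [2, 3, 4], ∀ y ∈ [2, 3, 4], ∀ z ∈ [2, 3, 4],
    (x = 2 ∨ y = 2 ∨ z = 2) → ¬ (x = 4 ∧ y = 4) → ¬ (x = 4 ∧ z = 4) → ¬ (y = 4 ∧ z = 4) →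
      cubeTest (braidCompl (tripleLabels x y z)) 30 0 1 2 = true := by
  decide +kernel

theorem cubeCondition_of_labels {S : Type*} (M : CoxeterMatrix S) {r s t : S}
    (hx : M r s ∈ [2, 3, 4]) (hy : M r t ∈ [2, 3, 4]) (hz : M s t ∈ [2, 3, 4])
    (h2 : M r s = 2 ∨ M r t = 2 ∨ M s t = 2) (h4 : ¬ (M r s = 4 ∧ M r t = 4))
    (h4' : ¬ (M r s = 4 ∧ M s t = 4)) (h4'' : ¬ (M r t = 4 ∧ M s t = 4)) :
    CubeCondition (braidCompl M) 30 r s t := by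
  have h := cubeCondition_of_cubeTest
    (cubeTest_tripleLabels _ hx _ hy _ hz h2 h4 h4' h4'')
  refine CubeCondition.map ![r, s, t] (fun i j => ?_) h
  change altList _ _ (M _ _ - 1) = (altList _ _ _).map _
  rw [map_altList]
  congr 2
  fin_cases i <;> fin_cases j <;> simp [tripleLabels, M.symmetric]

/-! ### Type `B` -/

theorem hom_jucysMurphy {G H : Type*} [Monoid G] [CommMonoid H] (φ : G →* H) {σ : ℕ → G} {k : ℕ}
    {b : H} (hb : ∀ i, 1 ≤ i → i ≤ k → φ (σ i) = b) :
    φ (jucysMurphy σ k) = φ (σ 0) * b ^ (2 * k) := by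
  induction k with
  | zero => simp [jucysMurphy]
  | succ k ih =>
    rw [jucysMurphy, map_mul, map_mul, ih fun i h1 h2 => hb i h1 (by omega),
      hb (k + 1) (by omega) le_rfl, show 2 * (k + 1) = 2 * k + 1 + 1 by omega, pow_succ', pow_succ,
      mul_assoc, mul_left_comm]

theorem hom_garsideB {G H : Type*} [Monoid G] [CommMonoid H] (φ : G →* H) {σ : ℕ → G} {k : ℕ}
    {b : H} (hb : ∀ i, 1 ≤ i → i ≤ k → φ (σ i) = b) :
    φ (garsideB σ k) = (φ (σ 0) * b ^ k) ^ (k + 1) := by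
  induction k with
  | zero => simp [garsideB]
  | succ k ih =>
    rw [garsideB, map_mul, ih fun i h1 h2 => hb i h1 (by omega), hom_jucysMurphy φ hb, mul_pow,
      mul_pow, mul_mul_mul_comm, ← pow_succ, ← pow_mul, ← pow_mul, ← pow_add]
    congr 2
    ring

theorem coxeterB_apply (n : ℕ) (i j : Fin n) :
    CoxeterMatrix.B n i j = if i = j then 1
      else if (i : ℕ) = n - 1 ∧ (j : ℕ) = n - 2 ∨ (j : ℕ) = n - 1 ∧ (i : ℕ) = n - 2 then 4
        else if (j : ℕ) + 1 = i ∨ (i : ℕ) + 1 = j then 3 else 2 := rfl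

theorem coxeterB_cases {n : ℕ} {i j : Fin n} (hij : i ≠ j) :
    (CoxeterMatrix.B n i j = 2 ∧ (j : ℕ) + 1 ≠ i ∧ (i : ℕ) + 1 ≠ j) ∨
    (CoxeterMatrix.B n i j = 3 ∧ ((j : ℕ) + 1 = i ∨ (i : ℕ) + 1 = j)) ∨
    (CoxeterMatrix.B n i j = 4 ∧
      ((i : ℕ) = n - 1 ∧ (j : ℕ) + 1 = i ∨ (j : ℕ) = n - 1 ∧ (i : ℕ) + 1 = j)) := by
  have hne : (i : ℕ) ≠ j := fun h => hij (Fin.ext h)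
  rw [coxeterB_apply, if_neg hij]
  split_ifs with h1 h2
  · exact Or.inr (Or.inr ⟨rfl, by omega⟩)
  · exact Or.inr (Or.inl ⟨rfl, h2⟩)
  · exact Or.inl ⟨rfl, by omega⟩

theorem coxeterB_ne_zero {n : ℕ} (i j : Fin n) : CoxeterMatrix.B n i j ≠ 0 := by
  rw [coxeterB_apply]
  split_ifs <;> simp

theorem lcmProperty_B (n : ℕ) : LcmProperty (braidCompl (CoxeterMatrix.B n)) := by
  refine lcmProperty_of_cube (n := 30) (length_braidCompl _) (braidCompl_self _) ?_
  intro r s t hrs hst hrt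
  have h1 : (r : ℕ) ≠ s := fun h => hrs (Fin.ext h)
  have h2 : (s : ℕ) ≠ t := fun h => hst (Fin.ext h)
  have h3 : (r : ℕ) ≠ t := fun h => hrt (Fin.ext h)
  have hr := r.2
  have hs := s.2
  have ht := t.2
  apply cubeCondition_of_labels <;>
  · rcases coxeterB_cases hrs with ⟨e1, _⟩ | ⟨e1, _⟩ | ⟨e1, _⟩ <;>
    rcases coxeterB_cases hrt with ⟨e2, _⟩ | ⟨e2, _⟩ | ⟨e2, _⟩ <;>
    rcases coxeterB_cases hst with ⟨e3, _⟩ | ⟨e3, _⟩ | ⟨e3, _⟩ <;>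
    first
    | omega
    | simp [e1, e2, e3]

/-- The generators in type `B`, numbered from the end of the Coxeter graph with label `4`. -/
def genB (N i : ℕ) : Fin (N + 1) := ⟨N - i, by omega⟩

theorem label_genB {N i j : ℕ} (hij : i < j) (hj : j ≤ N) :
    CoxeterMatrix.B (N + 1) (genB N i) (genB N j) =
      if j = i + 1 then if i = 0 then 4 else 3 else 2 := by
  have hi' : (genB N i : ℕ) = N - i := rfl
  have hj' : (genB N j : ℕ) = N - j := rfl
  rw [coxeterB_apply, if_neg (by rw [Fin.ext_iff]; omega)]
  by_cases h1 : j = i + 1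
  · by_cases h2 : i = 0
    · rw [if_pos h1, if_pos h2, if_pos (by omega)]
    · rw [if_pos h1, if_neg h2, if_neg (by omega), if_pos (by omega)]
  · rw [if_neg h1, if_neg (by omega), if_neg (by omega)]

theorem bRelations_genB (N : ℕ) :
    BRelations (fun i => gen (braidCompl (CoxeterMatrix.B (N + 1))) (genB N i)) N := by
  have hL := lcmProperty_B (N + 1)
  have hcompl : ∀ i j, i < j → j ≤ N →
      braidCompl (CoxeterMatrix.B (N + 1)) (genB N i) (genB N j) =
        altList (genB N j) (genB N i) ((if j = i + 1 then if i = 0 then 4 else 3 else 2) - 1) ∧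
      braidCompl (CoxeterMatrix.B (N + 1)) (genB N j) (genB N i) =
        altList (genB N i) (genB N j) ((if j = i + 1 then if i = 0 then 4 else 3 else 2) - 1) := by
    intro i j hij hj
    simp only [braidCompl]
    rw [CoxeterMatrix.symmetric _ (genB N j), label_genB hij hj]
    exact ⟨rfl, rfl⟩
  have hrel : ∀ i j, gen (braidCompl (CoxeterMatrix.B (N + 1))) (genB N i) *
        word _ (braidCompl (CoxeterMatrix.B (N + 1)) (genB N i) (genB N j)) =
      gen _ (genB N j) * word _ (braidCompl (CoxeterMatrix.B (N + 1)) (genB N j) (genB N i)) :=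
    fun i j => gen_mul_word _ _ _
  refine ⟨fun x y z => hL.mul_left_cancel (braidCompl_self _), ?_, ?_, ?_, ?_, ?_, ?_⟩
  · intro i j hij hj
    have h := hrel i j
    rw [(hcompl i j (by omega) hj).1, (hcompl i j (by omega) hj).2] at h
    simp only [if_neg (show j ≠ i + 1 by omega)] at h
    exact h
  · intro i hi hj
    have h := hrel i (i + 1)
    rw [(hcompl i (i + 1) (by omega) hj).1, (hcompl i (i + 1) (by omega) hj).2] at h
    simp only [if_neg (show i ≠ 0 by omega)] at h
    exact h
  · intro hN
    have h := hrel 0 1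
    rw [(hcompl 0 1 (by omega) hN).1, (hcompl 0 1 (by omega) hN).2] at h
    exact h
  · intro i j x y hij hj hxy
    obtain ⟨z, h, -⟩ := hL _ _ x y hxy
    rw [(hcompl i j (by omega) hj).1] at h
    simp only [if_neg (show j ≠ i + 1 by omega)] at h
    exact ⟨z, h⟩
  · intro i x y hi hj hxy
    obtain ⟨z, h, h'⟩ := hL _ _ x y hxy
    rw [(hcompl i (i + 1) (by omega) hj).1] at h
    rw [(hcompl i (i + 1) (by omega) hj).2] at h'
    simp only [if_neg (show i ≠ 0 by omega)] at h h'
    refine ⟨z, h.trans ?_, h'.trans ?_⟩ <;>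
      simp [altList, word_cons, word_nil, mul_assoc]
  · intro x y hN hxy
    obtain ⟨z, h, h'⟩ := hL _ _ x y hxy
    rw [(hcompl 0 1 (by omega) hN).1] at h
    rw [(hcompl 0 1 (by omega) hN).2] at h'
    refine ⟨z, h.trans ?_, h'.trans ?_⟩ <;>
      simp [altList, word_cons, word_nil, mul_assoc]

theorem exists_genB {N : ℕ} (s : Fin (N + 1)) : ∃ i ≤ N, s = genB N i :=
  ⟨N - s, by omega, by ext; simp only [genB]; omega⟩

/-- The Jucys–Murphy element with index `k` has one letter `genB N 0` and `2 k` letters in the class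
of `genB N 1`; the sums over `k < n` are `n` and `n (n - 1)`. -/
theorem cyclicCenter_B {n : ℕ} (hn : 2 ≤ n) : CyclicCenter (CoxeterMatrix.B n) n (n - 1) := by
  obtain ⟨N, rfl⟩ : ∃ N, n = N + 1 := ⟨n - 1, by omega⟩
  have hN : 1 ≤ N := by omega
  have hB := bRelations_genB N
  have hM : ∀ s t, CoxeterMatrix.B (N + 1) s t ≠ 0 := coxeterB_ne_zero
  set σ := fun i => gen (braidCompl (CoxeterMatrix.B (N + 1))) (genB N i) with hσ
  have hcomm : ∀ s, Commute (gen _ s) (garsideB σ N) := by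
    intro s
    obtain ⟨i, hi, rfl⟩ := exists_genB s
    exact commute_garsideB hB hi le_rfl
  have hdvd : ∀ s, ∃ y, garsideB σ N = gen _ s * y := by
    intro s
    obtain ⟨i, hi, rfl⟩ := exists_genB s
    exact dvd_garsideB hB hi le_rfl
  have hclass : ∀ χ : ArtinGroup (CoxeterMatrix.B (N + 1)) →* Multiplicative ℤ, ∀ i, 1 ≤ i →
      i ≤ N → χ (PresentedGroup.of (genB N i)) = χ (PresentedGroup.of (genB N 1)) := by
    intro χ i h1
    induction i, h1 using Nat.le_induction with
    | base => exact fun _ => rfl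
    | succ i h1 ih =>
      intro hi
      rw [← ih (by omega)]
      refine (hom_eq_of_odd χ ?_).symm
      rw [label_genB (Nat.lt_succ_self i) hi, if_pos rfl, if_neg (by omega)]
      decide
  refine ⟨toArtin hM (garsideB σ N), genB N 0, genB N 1,
    center_eq_zpowers (lcmProperty_B _) hcomm hM hdvd ?_ ?_, ?_, ?_, ?_⟩
  · rintro p hp ⟨s, hs⟩ t
    have hedge : ∀ i, i + 1 ≤ N → (p (genB N i) ↔ p (genB N (i + 1))) := by
      intro i hi
      have h3 : 3 ≤ CoxeterMatrix.B (N + 1) (genB N i) (genB N (i + 1)) := by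
        rw [label_genB (Nat.lt_succ_self i) hi, if_pos rfl]
        split_ifs <;> omega
      exact ⟨fun h => hp _ _ h h3, fun h => hp _ _ h (by rwa [CoxeterMatrix.symmetric])⟩
    have hzero : ∀ i ≤ N, (p (genB N 0) ↔ p (genB N i)) := by
      intro i hi
      induction i with
      | zero => exact Iff.rfl
      | succ i ih => exact (ih (by omega)).trans (hedge i hi)
    obtain ⟨i, hi, rfl⟩ := exists_genB s
    obtain ⟨j, hj, rfl⟩ := exists_genB t
    exact (hzero j hj).1 ((hzero i hi).2 hs)
  · intro x hx hdx
    exact garsideB_dvd hB le_rfl (fun i _ => hx _) (fun i _ => hdx _)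
  · intro χ
    have h := hom_garsideB (χ.comp (toArtin hM)) (σ := σ) (k := N)
      (b := χ (PresentedGroup.of (genB N 1))) (fun i h1 hi => by
        rw [MonoidHom.comp_apply, hσ, toArtin_gen, hclass χ i h1 hi])
    rw [MonoidHom.comp_apply, MonoidHom.comp_apply, hσ, toArtin_gen] at h
    exact h
  · intro χ ψ h0 h1
    refine PresentedGroup.ext fun s => ?_
    obtain ⟨i, hi, rfl⟩ := exists_genB s
    rcases Nat.eq_zero_or_pos i with rfl | hpos
    · exact h0
    · rw [hclass χ i hpos hi, hclass ψ i hpos hi, h1]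
  · intro a b
    obtain ⟨χ, hχ⟩ := exists_hom (CoxeterMatrix.B (N + 1))
      (fun s : Fin (N + 1) => if s = genB N 0 then a else b) (by
      intro s t hst
      obtain ⟨i, hi, rfl⟩ := exists_genB s
      obtain ⟨j, hj, rfl⟩ := exists_genB t
      have key : ∀ i j, i < j → j ≤ N →
          Odd (CoxeterMatrix.B (N + 1) (genB N i) (genB N j)) →
          genB N i ≠ genB N 0 ∧ genB N j ≠ genB N 0 := by
        intro i j hij hj hodd
        rw [label_genB hij hj] at hodd
        have hi : i ≠ 0 := by
          rintro rfl
          rw [if_pos rfl] at hodd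
          split_ifs at hodd <;> exact absurd hodd (by decide)
        simp only [genB, ne_eq, Fin.mk.injEq]
        omega
      rcases lt_trichotomy i j with hij | rfl | hij
      · obtain ⟨h1, h2⟩ := key i j hij hj hst
        rw [if_neg h1, if_neg h2]
      · rfl
      · rw [CoxeterMatrix.symmetric] at hst
        obtain ⟨h1, h2⟩ := key j i hij hi hst
        rw [if_neg h1, if_neg h2])
    refine ⟨χ, by rw [hχ, if_pos rfl], ?_⟩
    rw [hχ, if_neg]
    simp only [genB, Fin.mk.injEq]
    omega

/-! ### Type `F₄` -/

theorem lcmProperty_F₄ : LcmProperty (braidCompl CoxeterMatrix.F₄) := by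
  refine lcmProperty_of_cube (n := 30) (length_braidCompl _) (braidCompl_self _) ?_
  intro r s t hrs hst hrt
  have h : ∀ r s t : Fin 4, r ≠ s → s ≠ t → r ≠ t →
      cubeTest (braidCompl CoxeterMatrix.F₄) 30 r s t = true := by
    decide +kernel
  exact cubeCondition_of_cubeTest (h r s t hrs hst hrt)

/-- The Garside word of type `F₄`, as found by reversing: the initial segments of length `3` and
`9` are the Garside words for the first two and the first three generators. -/
def garsideF₄ : List (Fin 4) :=
  [0, 1, 0] ++ [2, 1, 0, 2, 1, 2] ++ [3, 2, 1, 2, 3, 0, 1, 2, 1, 0, 3, 2, 1, 2, 3]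

theorem garsideF₄_dvd {x : ArtinMonoid CoxeterMatrix.F₄} (hx : ∀ s, ∃ y, x = gen _ s * y) :
    ∃ y, x = word _ garsideF₄ * y := by
  have hC := length_braidCompl CoxeterMatrix.F₄
  have h1 : wordRev (braidCompl CoxeterMatrix.F₄) 100 [0] [1] = some ([1, 0], [0, 1]) := by
    decide +kernel
  have h2 : wordRev (braidCompl CoxeterMatrix.F₄) 100 [0, 1, 0] [2] =
      some ([2, 1, 0, 2, 1, 2], [0, 1, 2, 1, 0, 1, 2, 1]) := by
    decide +kernel
  have h3 : wordRev (braidCompl CoxeterMatrix.F₄) 400 ([0, 1, 0] ++ [2, 1, 0, 2, 1, 2]) [3] =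
      some ([3, 2, 1, 2, 3, 0, 1, 2, 1, 0, 3, 2, 1, 2, 3],
        [0, 1, 0, 2, 3, 1, 2, 1, 0, 1, 2, 1, 3, 2, 1, 2, 3, 0, 1, 2, 1, 3, 2]) := by
    decide +kernel
  obtain ⟨y0, hy0⟩ := hx 0
  obtain ⟨y1, hy1⟩ := hx 1
  obtain ⟨y2, hy2⟩ := hx 2
  obtain ⟨y3, hy3⟩ := hx 3
  obtain ⟨z, rfl, -⟩ := lcmProperty_F₄.of_wordRev hC h1 (hy0.symm.trans hy1)
  rw [← mul_assoc] at hy0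
  obtain ⟨z, rfl, -⟩ := lcmProperty_F₄.of_wordRev hC h2 (hy0.symm.trans hy2)
  rw [← mul_assoc] at hy0
  obtain ⟨z, rfl, -⟩ := lcmProperty_F₄.of_wordRev hC h3 (hy0.symm.trans hy3)
  exact ⟨z, by rw [hy0, ← mul_assoc]; rfl⟩

theorem cyclicCenter_F₄ : CyclicCenter CoxeterMatrix.F₄ 12 1 := by
  have hM : ∀ s t, CoxeterMatrix.F₄ s t ≠ 0 := by
    have h : ∀ s t : Fin 4, 0 + CoxeterMatrix.F₄ s t ≠ 0 := by decide
    exact fun s t hst => h s t (by rw [hst])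
  have hcomm : ∀ s, Commute (gen _ s) (word (braidCompl CoxeterMatrix.F₄) garsideF₄) := by
    intro s
    have h : ∀ s, wordRev (braidCompl CoxeterMatrix.F₄) 400 (s :: garsideF₄) (garsideF₄ ++ [s]) =
        some ([], []) := by
      decide +kernel
    exact word_eq_of_wordRev _ (h s)
  have hdvd : ∀ s, ∃ y, word (braidCompl CoxeterMatrix.F₄) garsideF₄ = gen _ s * y := by
    intro s
    have h : ∀ s, ((wordRev (braidCompl CoxeterMatrix.F₄) 400 garsideF₄ [s]).map Prod.fst) =
        some [] := by
      decide +kernel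
    obtain ⟨⟨_, v⟩, h1, rfl⟩ := Option.map_eq_some_iff.1 (h s)
    exact ⟨word _ v, by simpa [word_nil, gen] using wordRev_sound _ h1⟩
  have h01 : ∀ χ : ArtinGroup CoxeterMatrix.F₄ →* Multiplicative ℤ,
      χ (PresentedGroup.of 1) = χ (PresentedGroup.of 0) := fun χ => hom_eq_of_odd χ (by decide)
  have h23 : ∀ χ : ArtinGroup CoxeterMatrix.F₄ →* Multiplicative ℤ,
      χ (PresentedGroup.of 3) = χ (PresentedGroup.of 2) := fun χ => hom_eq_of_odd χ (by decide)
  refine ⟨toArtin hM (word _ garsideF₄), 0, 2,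
    center_eq_zpowers lcmProperty_F₄ hcomm hM hdvd ?_ (fun x _ => garsideF₄_dvd), ?_, ?_, ?_⟩
  · rintro p hp ⟨s, hs⟩ t
    have h10 : p 0 ↔ p 1 := ⟨fun h => hp _ _ h (by decide), fun h => hp _ _ h (by decide)⟩
    have h12 : p 1 ↔ p 2 := ⟨fun h => hp _ _ h (by decide), fun h => hp _ _ h (by decide)⟩
    have h32 : p 2 ↔ p 3 := ⟨fun h => hp _ _ h (by decide), fun h => hp _ _ h (by decide)⟩
    fin_cases s <;> fin_cases t <;> simp_all
  · intro χ
    rw [hom_toArtin_word]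
    simp only [garsideF₄, List.cons_append, List.nil_append, List.map_cons, List.map_nil,
      List.prod_cons, List.prod_nil, h01, h23]
    rw [← Multiplicative.toAdd.injective.eq_iff]
    simp only [toAdd_mul, toAdd_pow, toAdd_one]
    ring
  · intro χ ψ h0 h2
    refine PresentedGroup.ext fun s => ?_
    fin_cases s
    · exact h0
    · exact (h01 χ).trans (h0.trans (h01 ψ).symm)
    · exact h2
    · exact (h23 χ).trans (h2.trans (h23 ψ).symm)
  · intro a b
    obtain ⟨χ, hχ⟩ := exists_hom CoxeterMatrix.F₄ ![a, a, b, b] (by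
      intro s t hst
      have h : ∀ s t : Fin 4, CoxeterMatrix.F₄ s t % 2 = 1 → (s < 2 ↔ t < 2) := by decide
      have h' := h s t (Nat.odd_iff.1 hst)
      revert h'
      fin_cases s <;> fin_cases t <;> simp)
    exact ⟨χ, hχ 0, hχ 2⟩

/-! ### Transvections -/

section Transvection

variable {A : Type*} [Group A] {ζ : A}

/-- The endomorphism `x ↦ x ζ ^ χ(x)`, for a central element `ζ` and a homomorphism `χ` to `ℤ`. -/
def transvectionHom (hζ : ζ ∈ Subgroup.center A) (χ : A →* Multiplicative ℤ) : A →* A where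
  toFun x := x * ζ ^ (χ x).toAdd
  map_one' := by simp
  map_mul' x y := by
    have h : ∀ k : ℤ, y * ζ ^ k = ζ ^ k * y :=
      fun k => (Commute.zpow_right (Subgroup.mem_center_iff.1 hζ y) k)
    rw [map_mul, toAdd_mul, zpow_add, mul_assoc x, ← mul_assoc y, h, mul_assoc (ζ ^ _), ← mul_assoc x]

theorem transvectionHom_apply (hζ : ζ ∈ Subgroup.center A) (χ : A →* Multiplicative ℤ) (x : A) :
    transvectionHom hζ χ x = x * ζ ^ (χ x).toAdd := rfl

theorem transvectionHom_comp (hζ : ζ ∈ Subgroup.center A) (χ ψ : A →* Multiplicative ℤ) (x : A) :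
    transvectionHom hζ χ (transvectionHom hζ ψ x) =
      x * ζ ^ ((χ x).toAdd + (1 + (χ ζ).toAdd) * (ψ x).toAdd) := by
  rw [transvectionHom_apply, transvectionHom_apply, map_mul, map_zpow, toAdd_mul, toAdd_zpow,
    mul_assoc, ← zpow_add, smul_eq_mul]
  congr 2
  ring

/-- The endomorphism `x ↦ x ζ ^ χ(x)` multiplies `ζ` by the exponent `1 + χ(ζ)`; it is an
automorphism if this is a unit, and then its inverse comes from `- (1 + χ(ζ)) χ`. -/
def transvection (hζ : ζ ∈ Subgroup.center A) (χ : A →* Multiplicative ℤ)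
    (hχ : (1 + (χ ζ).toAdd) ^ 2 = 1) : MulAut A :=
  MonoidHom.toMulEquiv (transvectionHom hζ χ) (transvectionHom hζ (χ ^ (-(1 + (χ ζ).toAdd))))
    (by
      ext x
      rw [MonoidHom.comp_apply, transvectionHom_comp]
      simp only [MonoidHom.zpow_apply, toAdd_zpow, smul_eq_mul, MonoidHom.id_apply]
      have : -(1 + (χ ζ).toAdd) * (χ x).toAdd +
          (1 + -(1 + (χ ζ).toAdd) * (χ ζ).toAdd) * (χ x).toAdd = 0 := by
        linear_combination (-(χ x).toAdd) * hχ
      rw [this, zpow_zero, mul_one])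
    (by
      ext x
      rw [MonoidHom.comp_apply, transvectionHom_comp]
      simp only [MonoidHom.zpow_apply, toAdd_zpow, smul_eq_mul, MonoidHom.id_apply]
      have : (χ x).toAdd + (1 + (χ ζ).toAdd) * (-(1 + (χ ζ).toAdd) * (χ x).toAdd) = 0 := by
        linear_combination (-(χ x).toAdd) * hχ
      rw [this, zpow_zero, mul_one])

theorem transvection_apply (hζ : ζ ∈ Subgroup.center A) (χ : A →* Multiplicative ℤ)
    (hχ : (1 + (χ ζ).toAdd) ^ 2 = 1) (x : A) :
    transvection hζ χ hχ x = x * ζ ^ (χ x).toAdd := rfl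

theorem transvection_mem_Tv (hζ : ζ ∈ Subgroup.center A) (χ : A →* Multiplicative ℤ)
    (hχ : (1 + (χ ζ).toAdd) ^ 2 = 1) : transvection hζ χ hχ ∈ Tv A :=
  ⟨fun x => ⟨ζ ^ (χ x).toAdd, zpow_mem hζ _⟩, fun _ => rfl⟩

/-- If the centre is infinite cyclic, generated by `ζ`, then every transvection comes from a
homomorphism to `ℤ`. -/
theorem exists_hom_of_mem_Tv (hcenter : Subgroup.center A = Subgroup.zpowers ζ)
    (hinj : Function.Injective fun k : ℤ => ζ ^ k) {α : MulAut A} (hα : α ∈ Tv A) :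
    ∃ χ : A →* Multiplicative ℤ, ∀ x, α x = x * ζ ^ (χ x).toAdd := by
  obtain ⟨l, hl⟩ := hα
  have hmem : ∀ x, ∃ k : ℤ, ζ ^ k = (l x : A) := fun x => by
    rw [← Subgroup.mem_zpowers_iff, ← hcenter]
    exact (l x).2
  choose k hk using hmem
  refine ⟨MonoidHom.mk' (fun x => Multiplicative.ofAdd (k x)) fun x y => ?_, fun x => by
    rw [hl, ← hk]; rfl⟩
  rw [← ofAdd_add]
  congr 1
  apply hinj
  have h1 : α (x * y) = α x * α y := map_mul α x y
  have h2 : (l x : A) * y = y * l x := (Subgroup.mem_center_iff.1 (l x).2 y).symm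
  rw [hl, hl, hl, mul_assoc x (l x : A), ← mul_assoc (l x : A), h2, mul_assoc y, ← mul_assoc x] at h1
  have h3 := mul_left_cancel h1
  rw [← hk, ← hk, ← hk] at h3
  simpa [zpow_add] using h3

/-- Every automorphism preserves the centre, hence maps its generator to a generator. -/
theorem apply_generator (hcenter : Subgroup.center A = Subgroup.zpowers ζ)
    (hinj : Function.Injective fun k : ℤ => ζ ^ k) (α : MulAut A) : α ζ = ζ ∨ α ζ = ζ⁻¹ := by
  have hζ : ζ ∈ Subgroup.center A := hcenter ▸ Subgroup.mem_zpowers ζ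
  have hmem : ∀ β : MulAut A, ∃ k : ℤ, ζ ^ k = β ζ := fun β => by
    rw [← Subgroup.mem_zpowers_iff, ← hcenter, Subgroup.mem_center_iff]
    intro y
    have h := congrArg β (Subgroup.mem_center_iff.1 hζ (β⁻¹ y))
    rwa [map_mul, map_mul, MulAut.apply_inv_self] at h
  obtain ⟨j, hj⟩ := hmem α
  obtain ⟨k, hk⟩ := hmem α⁻¹
  have h : ζ ^ (j * k) = ζ ^ (1 : ℤ) := by
    rw [zpow_mul, hj, ← map_zpow, hk, MulAut.apply_inv_self, zpow_one]
  rcases Int.isUnit_iff.1 (IsUnit.of_mul_eq_one k (hinj h)) with rfl | rfl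
  · exact Or.inl (by rw [← hj, zpow_one])
  · exact Or.inr (by rw [← hj, zpow_neg_one])

/-- A conjugate of a transvection is a transvection, as the centre is characteristic. -/
instance normal_Tv : (Tv A).Normal where
  conj_mem := by
    rintro α ⟨l, hl⟩ g
    refine ⟨fun x => ⟨g (l (g⁻¹ x)), ?_⟩, fun x => ?_⟩
    · rw [Subgroup.mem_center_iff]
      intro y
      have h := congrArg g (Subgroup.mem_center_iff.1 (l (g⁻¹ x)).2 (g⁻¹ y))
      rwa [map_mul, map_mul, MulAut.apply_inv_self] at h
    · rw [MulAut.mul_apply, MulAut.mul_apply, hl, map_mul, MulAut.apply_inv_self]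

end Transvection

/-! ### The group of transvections of an Artin group -/

section TvArtin

variable {S : Type*} {M : CoxeterMatrix S} {n r : ℕ}

theorem zpow_injective_of_hom {A : Type*} [Group A] {ζ : A} (χ : A →* Multiplicative ℤ)
    (hχ : (χ ζ).toAdd ≠ 0) : Function.Injective fun k : ℤ => ζ ^ k := by
  intro i j hij
  have h := congrArg (fun x => (χ x).toAdd) hij
  simp only [map_zpow, toAdd_zpow, smul_eq_mul] at h
  exact mul_right_cancel₀ hχ h

/-- Transvections correspond to pairs of integers `(a, b)`, the exponents on the two classes of
generators, for which `1 + n (a + r b)`, the exponent on the generator of the centre, is a unit. -/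
theorem exists_Tv_parametrization (hc : CyclicCenter M n r) (hn : n ≠ 0) :
    ∃ T : ℤ → ℤ → MulAut (ArtinGroup M),
      (∀ a b, (1 + n * (a + r * b)) ^ 2 = (1 : ℤ) → T a b ∈ Tv (ArtinGroup M)) ∧
      (∀ a b a' b', (1 + n * (a + r * b)) ^ 2 = (1 : ℤ) → (1 + n * (a' + r * b')) ^ 2 = (1 : ℤ) →
        T a b * T a' b' =
          T (a + (1 + n * (a + r * b)) * a') (b + (1 + n * (a + r * b)) * b')) ∧
      (∀ a b a' b', (1 + n * (a + r * b)) ^ 2 = (1 : ℤ) → (1 + n * (a' + r * b')) ^ 2 = (1 : ℤ) →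
        T a b = T a' b' → a = a' ∧ b = b') ∧
      ∀ α ∈ Tv (ArtinGroup M), ∃ a b, (1 + n * (a + r * b)) ^ 2 = (1 : ℤ) ∧ T a b = α := by
  obtain ⟨ζ, s, t, hcenter, hval, huniq, hex⟩ := hc
  have hζ : ζ ∈ Subgroup.center (ArtinGroup M) := hcenter ▸ Subgroup.mem_zpowers ζ
  choose χ hχs hχt using fun a b : ℤ => hex (Multiplicative.ofAdd a) (Multiplicative.ofAdd b)
  have hχζ : ∀ a b, (χ a b ζ).toAdd = n * (a + r * b) := by
    intro a b
    rw [hval, hχs, hχt, toAdd_pow, toAdd_mul, toAdd_pow]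
    simp
  have hinj : Function.Injective fun k : ℤ => ζ ^ k :=
    zpow_injective_of_hom (χ 1 0) (by rw [hχζ]; simpa using hn)
  have hχadd : ∀ a b k a' b', χ (a + k * a') (b + k * b') = χ a b * χ a' b' ^ k := by
    intro a b k a' b'
    refine huniq _ _ ?_ ?_
    · rw [MonoidHom.mul_apply, MonoidHom.zpow_apply, hχs, hχs, hχs, ← ofAdd_zsmul, ← ofAdd_add,
        smul_eq_mul]
    · rw [MonoidHom.mul_apply, MonoidHom.zpow_apply, hχt, hχt, hχt, ← ofAdd_zsmul, ← ofAdd_add,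
        smul_eq_mul]
  have hunit : ∀ {a b : ℤ}, (1 + n * (a + r * b)) ^ 2 = (1 : ℤ) →
      (1 + (χ a b ζ).toAdd) ^ 2 = 1 := fun h => by rw [hχζ]; exact h
  let T : ℤ → ℤ → MulAut (ArtinGroup M) := fun a b =>
    if h : (1 + n * (a + r * b)) ^ 2 = (1 : ℤ) then transvection hζ (χ a b) (hunit h) else 1
  have hT : ∀ a b (h : (1 + n * (a + r * b)) ^ 2 = (1 : ℤ)),
      T a b = transvection hζ (χ a b) (hunit h) := fun a b h => dif_pos h
  refine ⟨T, ?_, ?_, ?_, ?_⟩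
  · intro a b h
    rw [hT a b h]
    exact transvection_mem_Tv _ _ _
  · intro a b a' b' h h'
    have h'' : (1 + n * ((a + (1 + n * (a + r * b)) * a') +
        r * (b + (1 + n * (a + r * b)) * b'))) ^ 2 = (1 : ℤ) := by
      have : (1 + n * ((a + (1 + n * (a + r * b)) * a') + r * (b + (1 + n * (a + r * b)) * b'))) =
          (1 + n * (a + r * b)) * (1 + n * (a' + r * b') : ℤ) := by ring
      rw [this, mul_pow, h, h', mul_one]
    rw [hT _ _ h, hT _ _ h', hT _ _ h'']
    ext x
    rw [MulAut.mul_apply]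
    refine (transvectionHom_comp hζ _ _ x).trans ?_
    rw [transvection_apply, hχadd, MonoidHom.mul_apply, MonoidHom.zpow_apply, toAdd_mul, toAdd_zpow,
      smul_eq_mul, hχζ]
  · intro a b a' b' h h' heq
    rw [hT _ _ h, hT _ _ h'] at heq
    have hx : ∀ x, χ a b x = χ a' b' x := fun x =>
      Multiplicative.toAdd.injective (hinj (mul_left_cancel (DFunLike.congr_fun heq x)))
    constructor
    · have := hx (PresentedGroup.of s)
      rwa [hχs, hχs, Multiplicative.ofAdd.injective.eq_iff] at this
    · have := hx (PresentedGroup.of t)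
      rwa [hχt, hχt, Multiplicative.ofAdd.injective.eq_iff] at this
  · intro α hα
    obtain ⟨ψ, hψ⟩ := exists_hom_of_mem_Tv hcenter hinj hα
    have hψχ : ψ = χ (ψ (PresentedGroup.of s)).toAdd (ψ (PresentedGroup.of t)).toAdd :=
      huniq _ _ (by rw [hχs, ofAdd_toAdd]) (by rw [hχt, ofAdd_toAdd])
    have hsq : (1 + (ψ ζ).toAdd) ^ 2 = 1 := by
      have h1 : α ζ = ζ ^ (1 + (ψ ζ).toAdd) := by rw [hψ, zpow_add, zpow_one]
      rcases apply_generator hcenter hinj α with h | h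
      · have : 1 + (ψ ζ).toAdd = 1 := hinj (h1.symm.trans (h.trans (zpow_one ζ).symm))
        rw [this, one_pow]
      · have : 1 + (ψ ζ).toAdd = -1 := hinj (h1.symm.trans (h.trans (zpow_neg_one ζ).symm))
        rw [this, neg_one_sq]
    have hsq' := hsq
    rw [hψχ, hχζ] at hsq'
    refine ⟨_, _, hsq', ?_⟩
    rw [hT _ _ hsq']
    ext x
    rw [transvection_apply, ← hψχ, hψ]

/-- For `n ≥ 3` the unit `1 + n (a + r b)` must be `1`, so that the exponents are `(-r b, b)` with
`b` arbitrary. -/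
theorem Tv_equiv_int (hc : CyclicCenter M n r) (hn : 3 ≤ n) :
    Nonempty (Tv (ArtinGroup M) ≃* Multiplicative ℤ) := by
  obtain ⟨T, hmem, hmul, hinj, hsurj⟩ := exists_Tv_parametrization hc (by omega)
  have hv : ∀ b : ℤ, (1 + n * (-(r * b) + r * b)) ^ 2 = (1 : ℤ) := fun b => by ring
  let F : Multiplicative ℤ →* Tv (ArtinGroup M) :=
    MonoidHom.mk' (fun b => ⟨T (-(r * b.toAdd)) b.toAdd, hmem _ _ (hv _)⟩) fun b b' => by
      apply Subtype.ext
      change T (-(r * (b.toAdd + b'.toAdd))) (b.toAdd + b'.toAdd) =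
        T (-(r * b.toAdd)) b.toAdd * T (-(r * b'.toAdd)) b'.toAdd
      rw [hmul _ _ _ _ (hv _) (hv _)]
      congr 1 <;> ring
  refine ⟨(MulEquiv.ofBijective F ⟨fun b b' h => ?_, fun ⟨α, hα⟩ => ?_⟩).symm⟩
  · exact Multiplicative.toAdd.injective
      (hinj _ _ _ _ (hv _) (hv _) (congrArg Subtype.val h)).2
  · obtain ⟨a, b, hab, rfl⟩ := hsurj α hα
    have ha : a = -(r * b) := by
      have h0 : (n * (a + r * b) : ℤ) = 0 ∨ (n * (a + r * b) : ℤ) = -2 := by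
        rcases sq_eq_one_iff.1 hab with h | h <;> omega
      rcases h0 with h | h
      · rcases mul_eq_zero.1 h with h | h
        · omega
        · omega
      · have hdvd : (n : ℤ) ∣ 2 := ⟨-(a + r * b), by rw [mul_neg, h, neg_neg]⟩
        have := Int.le_of_dvd (by norm_num) hdvd
        omega
    exact ⟨Multiplicative.ofAdd b, Subtype.ext (by subst ha; rfl)⟩

/-- If the centre is generated by an element of weights `(2, 2)` on the two classes of generators,
then `a + b` is `0` or `-1`, which gives the rotations and the reflections of `D_∞`. -/
theorem Tv_equiv_dihedral (hc : CyclicCenter M 2 1) :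
    Nonempty (Tv (ArtinGroup M) ≃* DihedralGroup 0) := by
  obtain ⟨T, hmem, hmul, hinj, hsurj⟩ := exists_Tv_parametrization hc (by omega)
  have hv : ∀ i : ℤ, (1 + (2 : ℕ) * (-i + (1 : ℕ) * i)) ^ 2 = (1 : ℤ) := fun i => by
    push_cast; ring
  have hv' : ∀ i : ℤ, (1 + (2 : ℕ) * (i - 1 + (1 : ℕ) * -i)) ^ 2 = (1 : ℤ) := fun i => by
    push_cast; ring
  let F : DihedralGroup 0 →* Tv (ArtinGroup M) :=
    MonoidHom.mk' (fun x => match x with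
      | .r i => ⟨T (-(show ℤ from i)) (show ℤ from i), hmem _ _ (hv _)⟩
      | .sr i => ⟨T ((show ℤ from i) - 1) (-(show ℤ from i)), hmem _ _ (hv' _)⟩) (by
      rintro ((i : ℤ) | (i : ℤ)) ((j : ℤ) | (j : ℤ))
      · apply Subtype.ext
        change T (-(i + j)) (i + j) = T (-i) i * T (-j) j
        rw [hmul _ _ _ _ (hv _) (hv _)]
        congr 1 <;> push_cast <;> ring
      · apply Subtype.ext
        change T (j - i - 1) (-(j - i)) = T (-i) i * T (j - 1) (-j)
        rw [hmul _ _ _ _ (hv _) (hv' _)]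
        congr 1 <;> push_cast <;> ring
      · apply Subtype.ext
        change T (i + j - 1) (-(i + j)) = T (i - 1) (-i) * T (-j) j
        rw [hmul _ _ _ _ (hv' _) (hv _)]
        congr 1 <;> push_cast <;> ring
      · apply Subtype.ext
        change T (-(j - i)) (j - i) = T (i - 1) (-i) * T (j - 1) (-j)
        rw [hmul _ _ _ _ (hv' _) (hv' _)]
        congr 1 <;> push_cast <;> ring)
  refine ⟨(MulEquiv.ofBijective F ⟨?_, fun ⟨α, hα⟩ => ?_⟩).symm⟩
  · rintro ((i : ℤ) | (i : ℤ)) ((j : ℤ) | (j : ℤ)) h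
    · have h' := (hinj _ _ _ _ (hv i) (hv j) (congrArg Subtype.val h)).2
      exact congrArg DihedralGroup.r h'
    · have h' := hinj _ _ _ _ (hv i) (hv' j) (congrArg Subtype.val h)
      omega
    · have h' := hinj _ _ _ _ (hv' i) (hv j) (congrArg Subtype.val h)
      omega
    · have h' := (hinj _ _ _ _ (hv' i) (hv' j) (congrArg Subtype.val h)).2
      exact congrArg DihedralGroup.sr (neg_injective h')
  · obtain ⟨a, b, hab, rfl⟩ := hsurj α hα
    have h0 : a = -b ∨ a = -b - 1 := by
      rcases sq_eq_one_iff.1 hab with h | h <;> push_cast at h <;> omega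
    rcases h0 with rfl | rfl
    · exact ⟨DihedralGroup.r (show ℤ from b), rfl⟩
    · refine ⟨DihedralGroup.sr (show ℤ from -b), Subtype.ext ?_⟩
      change T (-b - 1) (-(-b)) = _
      rw [neg_neg]

/-! ### The finite index subgroup -/

theorem finiteIndex_of_map {G X : Type*} [Group G] [Finite X] (K : Subgroup G) (w : G → X)
    (hw : ∀ g h, w g = w h → g⁻¹ * h ∈ K) : K.FiniteIndex := by
  have : Finite (G ⧸ K) := Finite.of_injective (fun q : G ⧸ K => w q.out) fun q q' h => by
    rw [← q.out_eq', ← q'.out_eq']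
    exact QuotientGroup.eq.2 (hw _ _ h)
  exact Subgroup.finiteIndex_of_finite_quotient

theorem len_of (s : S) : len M (PresentedGroup.of s) = Multiplicative.ofAdd 1 :=
  PresentedGroup.toGroup.of _

/-- Homomorphisms `f` and `g` to `ℤ` which agree on the central element `ζ`, and agree modulo `f ζ`
everywhere, differ by a transvection: `f` changes by `f ζ · χ` under `x ↦ x ζ ^ χ(x)`, so take
`χ = (g - f) / f ζ`. -/
theorem exists_transvection {A : Type*} [Group A] {ζ : A} (hζ : ζ ∈ Subgroup.center A)
    (f g : A →* Multiplicative ℤ) (hfg : f ζ = g ζ) (hne : (f ζ).toAdd ≠ 0)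
    (hmod : ∀ x, (f ζ).toAdd ∣ (g x).toAdd - (f x).toAdd) :
    ∃ τ ∈ Tv A, ∀ x, f (τ x) = g x := by
  let χ : A →* Multiplicative ℤ := MonoidHom.mk'
    (fun x => Multiplicative.ofAdd (((g x).toAdd - (f x).toAdd) / (f ζ).toAdd)) (by
      intro x y
      rw [← ofAdd_add, ← Int.add_ediv_of_dvd_left (hmod x)]
      rw [map_mul g, map_mul f, toAdd_mul, toAdd_mul, add_sub_add_comm])
  have hχ : ∀ x, (χ x).toAdd * (f ζ).toAdd = (g x).toAdd - (f x).toAdd :=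
    fun x => Int.ediv_mul_cancel (hmod x)
  have hχζ : (χ ζ).toAdd = 0 := by
    have h := hχ ζ
    rw [hfg, sub_self] at h
    exact (mul_eq_zero.1 h).resolve_right (hfg ▸ hne)
  refine ⟨transvection hζ χ (by rw [hχζ]; rfl), transvection_mem_Tv _ _ _, fun x => ?_⟩
  rw [transvection_apply, map_mul, map_zpow]
  apply Multiplicative.toAdd.injective
  rw [toAdd_mul, toAdd_zpow, smul_eq_mul, hχ]
  ring

/-- The map `α ↦ ℓ ∘ α` has the stabilizer `Aut*` of `± ℓ`, and transvections act on its values by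
translations. An automorphism is thus determined, up to `Tv` and `Aut*`, by its effect on `ζ` and
by `ℓ ∘ α` modulo `ℓ(ζ)`, which leaves finitely many cosets. The two subgroups meet trivially
because `ℓ(ζ)` does not divide `2`. -/
theorem semidirectFiniteIndex [Finite S] (hc : CyclicCenter M n r) (hn : 3 ≤ n * (1 + r)) :
    SemidirectFiniteIndex M := by
  obtain ⟨ζ, s, t, hcenter, hval, -, -⟩ := hc
  have hζ : ζ ∈ Subgroup.center (ArtinGroup M) := hcenter ▸ Subgroup.mem_zpowers ζ
  have hlen : (len M ζ).toAdd = ((n * (1 + r) : ℕ) : ℤ) := by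
    rw [hval, len_of, len_of, toAdd_pow, toAdd_mul, toAdd_pow]
    simp
  set N := n * (1 + r) with hN
  have hinj : Function.Injective fun k : ℤ => ζ ^ k :=
    zpow_injective_of_hom (len M) (by rw [hlen]; omega)
  let f : Tv (ArtinGroup M) ⋊[MulAut.conjNormal.comp (AutStar M).subtype] AutStar M →*
      MulAut (ArtinGroup M) :=
    SemidirectProduct.lift (Tv (ArtinGroup M)).subtype (AutStar M).subtype (by
      intro g
      ext τ : 1
      simp [MulAut.conj_apply])
  have hfl : ∀ τ, f (SemidirectProduct.inl τ) = (τ : MulAut (ArtinGroup M)) :=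
    fun τ => SemidirectProduct.lift_inl _ _ _ τ
  have hfr : ∀ g, f (SemidirectProduct.inr g) = (g : MulAut (ArtinGroup M)) :=
    fun g => SemidirectProduct.lift_inr _ _ _ g
  refine ⟨MulAut.conjNormal.comp (AutStar M).subtype, f, fun g τ => rfl, hfl, hfr, ?_, ?_⟩
  · -- A transvection in `Aut*` has `χ(x) ℓ(ζ)` equal to `0` or `-2 ℓ(x)` for all `x`.
    have htriv : ∀ α : MulAut (ArtinGroup M), α ∈ Tv (ArtinGroup M) → α ∈ AutStar M → α = 1 := by
      intro α hα hα'
      obtain ⟨χ, hχ⟩ := exists_hom_of_mem_Tv hcenter hinj hα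
      have hl : ∀ x, (len M (α x)).toAdd = (len M x).toAdd + (χ x).toAdd * N := fun x => by
        rw [hχ, map_mul, map_zpow, toAdd_mul, toAdd_zpow, smul_eq_mul, hlen]
      rcases hα' with h | h
      · ext x
        have hx := hl x
        rw [h, left_eq_add, mul_eq_zero] at hx
        rw [hχ, hx.resolve_right (by omega), zpow_zero, mul_one]
        rfl
      · have hx := hl (PresentedGroup.of s)
        rw [h, len_of, toAdd_inv, toAdd_ofAdd] at hx
        have hdvd : (N : ℤ) ∣ 2 := ⟨-(χ (PresentedGroup.of s)).toAdd, by linarith⟩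
        have := Int.le_of_dvd (by norm_num) hdvd
        omega
    rw [injective_iff_map_eq_one]
    intro x hx
    rw [← SemidirectProduct.inl_left_mul_inr_right x, map_mul, hfl, hfr] at hx
    have hl : (x.left : MulAut (ArtinGroup M)) = 1 := by
      refine htriv _ x.left.2 ?_
      rw [eq_inv_of_mul_eq_one_left hx]
      exact inv_mem x.right.2
    have hr : (x.right : MulAut (ArtinGroup M)) = 1 := by rwa [hl, one_mul] at hx
    exact SemidirectProduct.ext (Subtype.ext hl) (Subtype.ext hr)
  · have : NeZero N := ⟨by omega⟩
    refine finiteIndex_of_map (X := Prop × (S → ZMod N)) _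
      (fun γ => (γ⁻¹ ζ = ζ, fun s => ((len M (γ⁻¹ (PresentedGroup.of s))).toAdd : ZMod N))) ?_
    intro γ δ hγδ
    have h1 : γ⁻¹ ζ = ζ ↔ δ⁻¹ ζ = ζ := iff_of_eq (congrArg Prod.fst hγδ)
    have h2 := congrFun (congrArg Prod.snd hγδ)
    generalize hα : γ⁻¹ = α at h1 h2
    generalize hβ : δ⁻¹ = β at h1 h2
    have hδ : δ = β⁻¹ := by rw [← hβ, inv_inv]
    have hαβ : α ζ = β ζ := by
      rcases apply_generator hcenter hinj α with h | h
      · rw [h, h1.1 h]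
      · rcases apply_generator hcenter hinj β with h' | h'
        · rw [h', h1.2 h']
        · rw [h, h']
    have hζα : (len M (α ζ)).toAdd = N ∨ (len M (α ζ)).toAdd = -N := by
      rcases apply_generator hcenter hinj α with h | h
      · exact Or.inl (by rw [h, hlen])
      · exact Or.inr (by rw [h, map_inv, toAdd_inv, hlen])
    -- Congruence modulo `ℓ(ζ)` on the generators gives congruence on the whole group.
    have hmod : ∀ x, (N : ℤ) ∣ (len M (β x)).toAdd - (len M (α x)).toAdd := by
      let red : Multiplicative ℤ →* Multiplicative (ZMod N) :=
        AddMonoidHom.toMultiplicative (Int.castAddHom (ZMod N))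
      have heq : red.comp ((len M).comp α.toMonoidHom) = red.comp ((len M).comp β.toMonoidHom) :=
        PresentedGroup.ext fun s => congrArg Multiplicative.ofAdd (h2 s)
      intro x
      exact (ZMod.intCast_eq_intCast_iff_dvd_sub _ _ _).1
        (congrArg Multiplicative.toAdd (DFunLike.congr_fun heq x))
    obtain ⟨τ, hτ, hτl⟩ := exists_transvection hζ ((len M).comp α.toMonoidHom)
      ((len M).comp β.toMonoidHom) (congrArg (len M) hαβ)
      (by
        change (len M (α ζ)).toAdd ≠ 0
        omega)
      (by
        intro x
        change (len M (α ζ)).toAdd ∣ _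
        rcases hζα with h | h
        · rw [h]; exact hmod x
        · rw [h, neg_dvd]; exact hmod x)
    have hg : α * τ * β⁻¹ ∈ AutStar M := Or.inl fun x => by
      have h := hτl (β⁻¹ x)
      change len M (α (τ (β⁻¹ x))) = len M (β (β⁻¹ x)) at h
      rw [MulAut.apply_inv_self] at h
      exact h
    have hprod : α * δ = α * τ * β⁻¹ * (β * τ⁻¹ * β⁻¹) := by rw [hδ]; group
    rw [hprod]
    refine mul_mem ⟨SemidirectProduct.inr ⟨_, hg⟩, hfr _⟩ ⟨SemidirectProduct.inl ⟨_, ?_⟩, hfl _⟩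
    exact normal_Tv.conj_mem _ (inv_mem hτ) β

end TvArtin

end ArtinTv

theorem proposition3p2 :
    (∀ n : ℕ, 3 ≤ n → Nonempty (Tv (ArtinGroup (evenDihedral n)) ≃* Multiplicative ℤ)) ∧
    (∀ n : ℕ, 3 ≤ n → Nonempty (Tv (ArtinGroup (CoxeterMatrix.B n)) ≃* Multiplicative ℤ)) ∧
    Nonempty (Tv (ArtinGroup CoxeterMatrix.F₄) ≃* Multiplicative ℤ) ∧
    -- `DihedralGroup 0` is the infinite dihedral group
    Nonempty (Tv (ArtinGroup (evenDihedral 2)) ≃* DihedralGroup 0) ∧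
    Nonempty (Tv (ArtinGroup (CoxeterMatrix.B 2)) ≃* DihedralGroup 0) ∧
    (∀ n : ℕ, 2 ≤ n → SemidirectFiniteIndex (evenDihedral n)) ∧
    (∀ n : ℕ, 2 ≤ n → SemidirectFiniteIndex (CoxeterMatrix.B n)) ∧
    SemidirectFiniteIndex CoxeterMatrix.F₄ := by
  refine ⟨fun n hn => Tv_equiv_int (cyclicCenter_evenDihedral (by omega)) hn,
    fun n hn => Tv_equiv_int (cyclicCenter_B (by omega)) hn,
    Tv_equiv_int cyclicCenter_F₄ (by norm_num),
    Tv_equiv_dihedral (cyclicCenter_evenDihedral le_rfl),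
    Tv_equiv_dihedral (cyclicCenter_B le_rfl),
    fun n hn => semidirectFiniteIndex (cyclicCenter_evenDihedral hn) (by omega),
    fun n hn => semidirectFiniteIndex (cyclicCenter_B hn) ?_,
    semidirectFiniteIndex cyclicCenter_F₄ (by norm_num)⟩
  rw [show 1 + (n - 1) = n by omega]
  nlinarith
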